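/- Let $F=\mathbb{Q}(x)$ be the field of fractions of $\mathbb{Z}[x]$, let $n\ge 0$, and let $\mathscr{A}_n$ be the Temperley--Lieb algebra over $F$: the unital associative $F$-algebra generated by $e_1,\dots,e_{n-1}$ with relations $e_i^2=xe_i$, $e_ie_{i\pm1}e_i=e_i$, and $e_ie_j=e_je_i$ for $|i-j|\ge2$. A *partition* of $n$ is a pair $\lambda=(i,n-2i)$ with $0\le 2i\le n$; for partitions $\lambda=(i,n-2i)$, $\mu=(j,n-2j)$ of $n$ write $\lambda\unrhd\mu$ if $i\ge j$, and $\lambda\rhd\mu$ if $\lambda\unrhd\mu$ and $\lambda\neq\mu$. For a partition $\mu$ of $n-1$ write $\mu\to(i,n-2i)$ if $\mu=(i,n-2i-1)$ or $\mu=(i-1,n-2i+1)$. Let $\mathfrak{T}_n(\lambda)$ be the set of sequences $\mathfrak{t}=(\lambda^{(0)},\dots,\lambda^{(n)})$, $\lambda^{(k)}$ a partition of $k$, with $\lambda^{(0)}=(0,0)$, $\lambda^{(k-1)}\to\lambda^{(k)}$ for $1\le k\le n$, and $\lambda^{(n)}=\lambda$; write $\mathfrak{t}|_k=(\lambda^{(0)},\dots,\lambda^{(k)})$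 and $\mathrm{Shape}(\mathfrak{t}|_k)=\lambda^{(k)}$. Write $\mathfrak{s}\unrhd\mathfrak{t}$ if $\mathrm{Shape}(\mathfrak{s}|_k)\unrhd\mathrm{Shape}(\mathfrak{t}|_k)$ for all $k$, and $\mathfrak{s}\rhd\mathfrak{t}$ if moreover $\mathfrak{s}\ne\mathfrak{t}$. For $\lambda=(f,n-2f)$ put $m_\lambda=e_1e_3\cdots e_{2f-1}$, and let $\check{\mathscr{A}}_n^\lambda$ be the sum of the two-sided ideals generated by the $m_\mu$ with $\mu\rhd\lambda$. Let $C^\lambda$ be the right $\mathscr{A}_n$-submodule of $\mathscr{A}_n/\check{\mathscr{A}}_n^\lambda$ generated by the class of $m_\lambda$. Put $w_{i,j}=e_ie_{i+1}\cdots e_{j-1}$ if $i<j$, $w_{i,j}=e_{i-1}e_{i-2}\cdots e_j$ if $j<i$, and $w_{i,i}=1$. For $\mathfrak{t}\in\mathfrak{T}_n(\lambda)$ define $v_\mathfrak{t}$ and $v_\mathfrak{t}^*$ recursively by $v_{((0,0))}=v_{((0,0))}^*=1$ and, with $\mathfrak{s}=\mathfrak{t}|_{n-1}$, $v_\mathfrak{t}=v_\mathfrak{s}$,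 $v_\mathfrak{t}^*=v_\mathfrak{s}^*$ if $\mathrm{Shape}(\mathfrak{s})=(f,n-2f-1)$, and $v_\mathfrak{t}=w_{2f,n}v_\mathfrak{s}$, $v_\mathfrak{t}^*=v_\mathfrak{s}^*w_{n,2f}$ if $\mathrm{Shape}(\mathfrak{s})=(f-1,n-2f+1)$. Let $m_{\mathfrak{u}\mathfrak{v}}=v_\mathfrak{u}^*m_\lambda v_\mathfrak{v}$ and let $m_\mathfrak{t}\in C^\lambda$ be the class of $m_\lambda v_\mathfrak{t}$. The cellular bilinear form $\langle\,,\rangle$ on $C^\lambda$ is the unique $F$-bilinear form with $$m_{\mathfrak{u}\mathfrak{s}}m_{\mathfrak{t}\mathfrak{v}}\equiv\langle m_\mathfrak{s},m_\mathfrak{t}\rangle\, m_{\mathfrak{u}\mathfrak{v}} \pmod{\check{\mathscr{A}}_n^\lambda}\qquad(\mathfrak{s},\mathfrak{t},\mathfrak{u},\mathfrak{v}\in\mathfrak{T}_n(\lambda)).$$ Define $T_0=T_1=0$, $T_2=e_1$, $z_i=\sum_{k=0}^i x^kT_{i-k}$ and, for $i\ge2$, $T_{i+1}=-e_iT_i-T_ie_i+e_ie_{i-1}T_ie_i-z_{i-1}-e_iz_{i-2}$.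 Let $p_0=0$, $p_1=1$, $p_{i+1}=xp_i-p_{i-1}$. For $\mathfrak{t}\in\mathfrak{T}_n(\lambda)$ put $r_\mathfrak{t}(0)=r_\mathfrak{t}(1)=0$ and, for $2\le k\le n$ with $\mathrm{Shape}(\mathfrak{t}|_k)=(i,k-2i)$, $r_\mathfrak{t}(k)=(p_i-xp_{i-1})p_{k-i+1}$ if $\mathrm{Shape}(\mathfrak{t}|_{k-1})=(i-1,k-2i+1)$ and $r_\mathfrak{t}(k)=(p_{k-i+1}-xp_{k-i})p_i$ if $\mathrm{Shape}(\mathfrak{t}|_{k-1})=(i,k-2i-1)$; put $z_\mathfrak{t}(k)=\sum_{i=0}^kx^ir_\mathfrak{t}(k-i)$. Let $\mathfrak{R}(k)=\{r_\mathfrak{t}(k):\mathfrak{t}\in\mathfrak{T}_k(\mu),\ \mu\text{ a partition of }k\}$ and $$F_\mathfrak{t}=\prod_{k=2}^n\ \prod_{\substack{r\in\mathfrak{R}(k)\\ r\ne r_\mathfrak{t}(k)}}\frac{T_k-r}{r_\mathfrak{t}(k)-r},\qquad f_\mathfrak{t}=m_\mathfrak{t}F_\mathfrak{t}\in C^\lambda$$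 (outer product in increasing order of $k$). Let $\lambda$ be a partition of $n$. Then the cellular bilinear form on $C^\lambda$ exists and is unique, and: 1. for each $\mathfrak{t}\in\mathfrak{T}_n(\lambda)$ there exist $a_\mathfrak{u}\in F$ with $f_\mathfrak{t}=m_\mathfrak{t}+\sum_{\mathfrak{u}\rhd\mathfrak{t}}a_\mathfrak{u}m_\mathfrak{u}$, the sum being over $\mathfrak{u}\in\mathfrak{T}_n(\lambda)$ with $\mathfrak{u}\rhd\mathfrak{t}$; 2. the family $(f_\mathfrak{t})_{\mathfrak{t}\in\mathfrak{T}_n(\lambda)}$ is an $F$-basis of $C^\lambda$; 3. for $\mathfrak{s},\mathfrak{t}\in\mathfrak{T}_n(\lambda)$, $\langle f_\mathfrak{s},f_\mathfrak{t}\rangle=0$ if $\mathfrak{s}\ne\mathfrak{t}$, and $\langle f_\mathfrak{t},f_\mathfrak{t}\rangle\ne0$; 4. for $\mathfrak{t}\in\mathfrak{T}_n(\lambda)$ and $0\le k\le n$, $f_\mathfrak{t}T_k=r_\mathfrak{t}(k)f_\mathfrak{t}$ and $f_\mathfrak{t}z_k=z_\mathfrak{t}(k)f_\mathfrak{t}$.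 -/

import Mathlib

namespace TemperleyLieb

open Polynomial

/-! ### The algebra -/

/-- Indices `1, …, n - 1` of the generators. -/
abbrev Gen (n : ℕ) : Type := {i : ℕ // 1 ≤ i ∧ i < n}

/-- Defining relations of the Temperley–Lieb algebra with loop parameter `x`. -/
inductive Rel (K : Type*) [CommRing K] (x : K) (n : ℕ) :
    FreeAlgebra K (Gen n) → FreeAlgebra K (Gen n) → Prop
  | sq (i : Gen n) :
      Rel K x n (FreeAlgebra.ι K i * FreeAlgebra.ι K i) (x • FreeAlgebra.ι K i)
  | adj (i j : Gen n) (h : j.1 = i.1 + 1 ∨ i.1 = j.1 + 1) :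
      Rel K x n (FreeAlgebra.ι K i * FreeAlgebra.ι K j * FreeAlgebra.ι K i) (FreeAlgebra.ι K i)
  | comm (i j : Gen n) (h : i.1 + 2 ≤ j.1 ∨ j.1 + 2 ≤ i.1) :
      Rel K x n (FreeAlgebra.ι K i * FreeAlgebra.ι K j) (FreeAlgebra.ι K j * FreeAlgebra.ι K i)

/-- The Temperley–Lieb algebra over `K` with parameter `x`, generated by `e 1, …, e (n - 1)`. -/
def TL (K : Type*) [CommRing K] (x : K) (n : ℕ) : Type _ := RingQuot (Rel K x n)

noncomputable instance (K : Type*) [CommRing K] (x : K) (n : ℕ) : Ring (TL K x n) :=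
  inferInstanceAs (Ring (RingQuot (Rel K x n)))

noncomputable instance (K : Type*) [CommRing K] (x : K) (n : ℕ) : Algebra K (TL K x n) :=
  inferInstanceAs (Algebra K (RingQuot (Rel K x n)))

/-- The quotient map from the free algebra. -/
noncomputable def TL.mk (K : Type*) [CommRing K] (x : K) (n : ℕ) :
    FreeAlgebra K (Gen n) →ₐ[K] TL K x n :=
  RingQuot.mkAlgHom K (Rel K x n)

/-- The generator `e i` for `1 ≤ i < n` (and `0` for the other, never used, indices). -/
noncomputable def e (K : Type*) [CommRing K] (x : K) (n : ℕ) (i : ℕ) : TL K x n :=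
  if h : 1 ≤ i ∧ i < n then TL.mk K x n (FreeAlgebra.ι K ⟨i, h⟩) else 0

/-- `w i j = e i * e (i+1) * ⋯ * e (j-1)` if `i < j`, `e (i-1) * e (i-2) * ⋯ * e j` if `j < i`,
and `1` if `i = j`. -/
noncomputable def w (K : Type*) [CommRing K] (x : K) (n : ℕ) (i j : ℕ) : TL K x n :=
  if i < j then ((List.range' i (j - i)).map (e K x n)).prod
  else if j < i then ((List.range' j (i - j)).reverse.map (e K x n)).prod
  else 1

/-! ### Partitions and paths -/

/-- A partition of `n`: a pair `(i, n - 2 i)` with `0 ≤ 2 i ≤ n`. -/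
@[ext] structure Part (n : ℕ) where
  fst : ℕ
  snd : ℕ
  sum_eq : 2 * fst + snd = n

theorem Part.fst_injective (n : ℕ) :
    Function.Injective (fun l : Part n => (⟨l.fst, by have := l.sum_eq; omega⟩ : Fin (n + 1))) := by
  intro a b h
  have h1 : a.fst = b.fst := by simpa using h
  have ha := a.sum_eq
  have hb := b.sum_eq
  exact Part.ext h1 (by omega)

noncomputable instance (n : ℕ) : Fintype (Part n) :=
  Fintype.ofInjective _ (Part.fst_injective n)

/-- `l ⊵ m`. -/
def Part.Dom {n : ℕ} (l m : Part n) : Prop := m.fst ≤ l.fst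

/-- `l ▷ m`. -/
def Part.SDom {n : ℕ} (l m : Part n) : Prop := l.Dom m ∧ l ≠ m

/-- `m → l`: either `l = (i, j + 1)` and `m = (i, j)`, or `l = (i + 1, j)` and `m = (i, j + 1)`. -/
def Part.Arrow {k n : ℕ} (m : Part k) (l : Part n) : Prop :=
  (l.fst = m.fst ∧ l.snd = m.snd + 1) ∨ (l.fst = m.fst + 1 ∧ m.snd = l.snd + 1)

/-- The set of paths `(λ⁽⁰⁾, …, λ⁽ⁿ⁾)` with `λ⁽⁰⁾ = (0,0)`, `λ⁽ᵏ⁻¹⁾ → λ⁽ᵏ⁾` and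
`λ⁽ⁿ⁾ = l`; the `k`-th entry is a partition of `k`. -/
def Path {n : ℕ} (l : Part n) : Type :=
  {s : (k : Fin (n + 1)) → Part k.1 //
    (∀ k : Fin n, (s k.castSucc).Arrow (s k.succ)) ∧ s (Fin.last n) = l}

noncomputable instance {n : ℕ} (l : Part n) : Fintype (Path l) := by
  classical
  exact inferInstanceAs (Fintype {s : (k : Fin (n + 1)) → Part k.1 //
    (∀ k : Fin n, (s k.castSucc).Arrow (s k.succ)) ∧ s (Fin.last n) = l})

/-- `t.idx k` is the `i` with `λ⁽ᵏ⁾ = (i, k - 2 i)`, for `k ≤ n`. -/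
def Path.idx {n : ℕ} {l : Part n} (t : Path l) (k : ℕ) : ℕ :=
  if h : k < n + 1 then (t.1 ⟨k, h⟩).fst else 0

/-- `s ⊵ t`. -/
def Path.Dom {n : ℕ} {l : Part n} (s t : Path l) : Prop := ∀ k, (s.1 k).Dom (t.1 k)

/-- `s ▷ t`. -/
def Path.SDom {n : ℕ} {l : Part n} (s t : Path l) : Prop := s.Dom t ∧ s ≠ t

noncomputable instance {n : ℕ} {l : Part n} (t : Path l) :
    DecidablePred (fun u : Path l => u.SDom t) := fun _ => Classical.propDecidable _

/-! ### Murphy elements and cell modules -/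

section Cell

variable (K : Type*) [CommRing K] (x : K) {n : ℕ}

/-- `m_λ = e 1 * e 3 * ⋯ * e (2 f - 1)` for `λ = (f, n - 2 f)`. -/
noncomputable def mPart (l : Part n) : TL K x n :=
  ((List.range l.fst).map (fun j => e K x n (2 * j + 1))).prod

/-- The element `v` of the truncated path `t|_k`, in the algebra on `n` strands. -/
noncomputable def vTrunc {l : Part n} (t : Path l) : ℕ → TL K x n
  | 0 => 1
  | k + 1 =>
    if t.idx (k + 1) = t.idx k then vTrunc t k
    else w K x n (2 * t.idx (k + 1)) (k + 1) * vTrunc t k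

/-- The element `v_t`. -/
noncomputable def v {l : Part n} (t : Path l) : TL K x n := vTrunc K x t n

/-- The element `v^*` of the truncated path `t|_k`, in the algebra on `n` strands. -/
noncomputable def vStarTrunc {l : Part n} (t : Path l) : ℕ → TL K x n
  | 0 => 1
  | k + 1 =>
    if t.idx (k + 1) = t.idx k then vStarTrunc t k
    else vStarTrunc t k * w K x n (k + 1) (2 * t.idx (k + 1))

/-- The element `v_t^*`. -/
noncomputable def vStar {l : Part n} (t : Path l) : TL K x n := vStarTrunc K x t n

/-- The cellular basis element `m_{uv} = v_u^* m_λ v_v`. -/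
noncomputable def mPair {l : Part n} (u t : Path l) : TL K x n :=
  vStar K x u * mPart K x l * v K x t

/-- The two-sided ideal generated by `m_λ`. -/
noncomputable def idealOf (l : Part n) : TwoSidedIdeal (TL K x n) :=
  TwoSidedIdeal.span {mPart K x l}

/-- The sum of the two-sided ideals generated by the `m_μ` with `μ ▷ λ`. -/
noncomputable def idealAbove (l : Part n) : TwoSidedIdeal (TL K x n) :=
  ⨆ (m : Part n) (_ : m.SDom l), idealOf K x m

/-- `idealAbove` as a right submodule of the algebra. -/
noncomputable def rightAbove (l : Part n) : Submodule (TL K x n)ᵐᵒᵖ (TL K x n) where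
  carrier := {a | a ∈ idealAbove K x l}
  add_mem' ha hb := (idealAbove K x l).add_mem ha hb
  zero_mem' := (idealAbove K x l).zero_mem
  smul_mem' c _ ha := (idealAbove K x l).mul_mem_right _ c.unop ha

/-- The cell module `C^λ`: the right submodule, generated by the class of `m_λ`, of the quotient
of the algebra by `idealAbove`. Right modules are modules over the opposite algebra. -/
noncomputable def cell (l : Part n) :
    Submodule (TL K x n)ᵐᵒᵖ (TL K x n ⧸ rightAbove K x l) :=
  Submodule.span _ {(rightAbove K x l).mkQ (mPart K x l)}

/-- The generator of `C^λ`, the class of `m_λ`. -/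
noncomputable def cellGen (l : Part n) : cell K x l :=
  ⟨(rightAbove K x l).mkQ (mPart K x l), Submodule.mem_span_singleton_self _⟩

/-- The Murphy basis element `m_t ∈ C^λ`, the class of `m_λ v_t`. -/
noncomputable def m {l : Part n} (t : Path l) : cell K x l :=
  MulOpposite.op (v K x t) • cellGen K x l

/-- `B` is the cellular bilinear form on `C^λ`, that is,
`m_{us} m_{tv} ≡ B (m_s, m_t) m_{uv}` modulo `idealAbove`. -/
def IsCellForm (l : Part n) (B : LinearMap.BilinForm K (cell K x l)) : Prop :=
  ∀ u s t r : Path l,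
    mPair K x u s * mPair K x t r - B (m K x s) (m K x t) • mPair K x u r ∈ idealAbove K x l

end Cell

/-! ### Jucys–Murphy elements -/

/-- `T_0 = T_1 = 0`, `T_2 = e_1` and, for `i ≥ 2` (below `i` is written `i + 2`),
`T_{i+1} = - e_i T_i - T_i e_i + e_i e_{i-1} T_i e_i - z_{i-1} - e_i z_{i-2}`, where
`z_j = ∑_{k=0}^{j} x^k T_{j-k}`. -/
noncomputable def T (K : Type*) [CommRing K] (x : K) (n : ℕ) : ℕ → TL K x n
  | 0 => 0
  | 1 => 0
  | 2 => e K x n 1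
  | i + 3 =>
    - (e K x n (i + 2) * T K x n (i + 2)) - T K x n (i + 2) * e K x n (i + 2)
      + e K x n (i + 2) * e K x n (i + 1) * T K x n (i + 2) * e K x n (i + 2)
      - (∑ k ∈ Finset.range (i + 2), x ^ k • T K x n (i + 1 - k))
      - e K x n (i + 2) * (∑ k ∈ Finset.range (i + 1), x ^ k • T K x n (i - k))
  termination_by i => i
  decreasing_by all_goals omega

/-- `z_i = ∑_{k=0}^{i} x^k T_{i-k}`. -/
noncomputable def z (K : Type*) [CommRing K] (x : K) (n : ℕ) (i : ℕ) : TL K x n :=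
  ∑ k ∈ Finset.range (i + 1), x ^ k • T K x n (i - k)

/-- `p_0 = 0`, `p_1 = 1`, `p_{i+1} = x p_i - p_{i-1}`. -/
def p (K : Type*) [CommRing K] (x : K) : ℕ → K
  | 0 => 0
  | 1 => 1
  | i + 2 => x * p K x (i + 1) - p K x i

/-- The content `r_t(k)`; here `i = t.idx k`, and the two nontrivial cases are
`λ⁽ᵏ⁻¹⁾ = (i - 1, k - 2 i + 1)` and `λ⁽ᵏ⁻¹⁾ = (i, k - 2 i - 1)`. -/
def r (K : Type*) [CommRing K] (x : K) {n : ℕ} {l : Part n} (t : Path l) (k : ℕ) : K :=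
  if k ≤ 1 then 0
  else if t.idx k = t.idx (k - 1) + 1 then
    (p K x (t.idx k) - x * p K x (t.idx k - 1)) * p K x (k - t.idx k + 1)
  else (p K x (k - t.idx k + 1) - x * p K x (k - t.idx k)) * p K x (t.idx k)

/-- `z_t(k) = ∑_{i=0}^{k} x^i r_t(k-i)`. -/
def zContent (K : Type*) [CommRing K] (x : K) {n : ℕ} {l : Part n} (t : Path l) (k : ℕ) : K :=
  ∑ i ∈ Finset.range (k + 1), x ^ i * r K x t (k - i)

/-! ### The orthogonal basis -/

section Seminormal

variable (F : Type*) [Field F] (x : F)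

open Classical in
/-- The set of all `r_t(k)`, for `t` a path of length `k`. -/
noncomputable def contents (k : ℕ) : Finset F :=
  Finset.univ.image (fun t : (Σ l : Part k, Path l) => r F x t.2 k)

open Classical in
/-- The factor `∏_{a ∈ contents k, a ≠ r_t(k)} (T_k - a) / (r_t(k) - a)`, written as the value at
`T_k` of a polynomial in one variable. -/
noncomputable def factor {n : ℕ} {l : Part n} (t : Path l) (k : ℕ) : TL F x n :=
  aeval (T F x n k)
    (∏ a ∈ (contents F x k).erase (r F x t k), C (r F x t k - a)⁻¹ * (X - C a))

/-- `F_t`, the product of `factor t k` over `k = 2, …, n`. -/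
noncomputable def bigF {n : ℕ} {l : Part n} (t : Path l) : TL F x n :=
  ((List.range' 2 (n - 1)).map (factor F x t)).prod

/-- `f_t = m_t F_t`. -/
noncomputable def f {n : ℕ} {l : Part n} (t : Path l) : cell F x l :=
  MulOpposite.op (bigF F x t) • m F x t

end Seminormal

end TemperleyLieb

namespace TemperleyLieb

open Polynomial

/-! ### The polynomials `p` -/

section ChebyshevP

variable {K : Type*} [CommRing K] (x : K)

/-! The algebra is made to act on functions on lattice paths, in the manner of Young's seminormal
form, and everything is read off in coordinates where the Jucys–Murphy elements are diagonal. At a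
path with a corner at `j + 1`, the generator `e (j + 1)` combines the values at the two ways round
the corner, with quotients of the Chebyshev polynomials `p` as coefficients (`stepOp`, `rep`). The
only fact needed about the field is that no `p (i + 1)` vanishes. In this representation `z k`
multiplies by `p i * p (k - i + 1)`, where `i` is the first component at step `k`, and `T k`
multiplies by the content, which is the value of `z k` minus `x` times that of `z (k - 1)`
(`isDiag_T`, `isDiag_z`).

The map `coord` sends the class of `y` in the cell module to the family of values at the most
dominant path of `y` applied to the indicators of the paths of shape `l`. It is well defined because
elements of `idealAbove` annihilate at paths ending in `l` (`rep_idealAbove`), and right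
multiplication by a diagonal element rescales each coordinate (`coord_isDiag`). The coordinates of
the `m t` are triangular for dominance with nonzero diagonal (`rep_walkV_eq_zero`,
`rep_walkV_leading`), so the `m t` are independent; an algebraic reduction shows that they span
(`oddProd_mul_mem`). Hence `coord` is injective.

Two paths that first differ at step `k` have different contents there (`walkContent_ne`). So `bigF
t` kills every coordinate except the one at `t`, which it preserves, and `f t` is a nonzero multiple
of a coordinate vector. Unitriangularity, the basis property and the eigenvalues follow.

A cellular form exists because `oddProd f * y * oddProd f` is a scalar multiple of `oddProd f`
modulo higher terms (`oddProd_sandwich_mem`). A weighted scalar product on paths makes the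
generators self-adjoint, hence `v t` and `vStar t` adjoint. Evaluating the defining congruence at
the most dominant path then shows that every cellular form is diagonal in `coord`, with explicit
nonzero weights (`isCellForm_eq_sum`). This gives uniqueness, orthogonality and nonvanishing. -/

theorem p_add_two (i : ℕ) : p K x (i + 2) = x * p K x (i + 1) - p K x i := rfl

/-- d'Ocagne's identity. -/
theorem p_mul_sub_p_mul (s a : ℕ) :
    p K x (s + 1) * p K x (a + s) - p K x s * p K x (a + s + 1) = p K x a := by
  induction s with
  | zero => simp [p]
  | succ s ih =>
    have h1 := p_add_two x s
    have h2 : p K x (a + (s + 1) + 1) = x * p K x (a + s + 1) - p K x (a + s) :=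
      p_add_two x (a + s)
    have h3 : a + (s + 1) = a + s + 1 := by omega
    rw [h2, h1, h3]
    linear_combination ih

theorem p_map {L : Type*} [CommRing L] (φ : K →+* L) (i : ℕ) :
    φ (p K x i) = p L (φ x) i := by
  induction i using Nat.twoStepInduction with
  | zero => simp [p]
  | one => simp [p]
  | more i h0 h1 => rw [p_add_two, p_add_two, map_sub, map_mul, h0, h1]

theorem p_two_eq (i : ℕ) : p ℤ 2 i = i := by
  induction i using Nat.twoStepInduction with
  | zero => simp [p]
  | one => simp [p]
  | more i h0 h1 => rw [p_add_two, h0, h1]; push_cast; ring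

/-- Already in `ℤ[X]` the polynomial is nonzero: specialising `X` to `2` turns it into the integer
`i + 1`. -/
theorem p_ne_zero {F : Type*} [Field F] [Algebra (Polynomial ℤ) F]
    [IsFractionRing (Polynomial ℤ) F] (i : ℕ) :
    p F (algebraMap (Polynomial ℤ) F X) (i + 1) ≠ 0 := by
  rw [← p_map, Ne, FaithfulSMul.algebraMap_eq_zero_iff]
  intro h
  have h2 := p_map (X : Polynomial ℤ) (evalRingHom 2) (i + 1)
  rw [h] at h2
  simp only [map_zero, coe_evalRingHom, eval_X, p_two_eq] at h2
  push_cast at h2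
  omega

end ChebyshevP

/-! ### Sequences satisfying the Temperley–Lieb relations -/

section Sequence

variable {F A : Type*} [Field F] [Ring A] [Algebra F A]

/-- The first `N` terms of `g` satisfy the Temperley–Lieb relations, except that some of them may
be zero. -/
structure IsTLSeq (x : F) (g : ℕ → A) (N : ℕ) : Prop where
  sq : ∀ i, i < N → g i * g i = x • g i
  adj : ∀ i, i + 1 < N → g i = 0 ∨ g (i + 1) * g i * g (i + 1) = g (i + 1)
  comm : ∀ i j, i + 2 ≤ j → j < N → g i * g j = g j * g i

variable (F) in
/-- The subalgebra generated by the first `k` terms of `g`. -/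
def lower (g : ℕ → A) (k : ℕ) : Subalgebra F A := Algebra.adjoin F (g '' Set.Iio k)

theorem lower_mono (g : ℕ → A) {j k : ℕ} (h : j ≤ k) : lower F g j ≤ lower F g k :=
  Algebra.adjoin_mono (Set.image_mono (Set.Iio_subset_Iio h))

theorem mem_lower (g : ℕ → A) {i k : ℕ} (h : i < k) : g i ∈ lower F g k :=
  Algebra.subset_adjoin ⟨i, h, rfl⟩

variable {x : F} {g : ℕ → A} {N : ℕ}

theorem IsTLSeq.commute_lower (hg : IsTLSeq x g N) {k j : ℕ} (hk : ∀ i < k, i + 2 ≤ j) (hj : j < N)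
    {y : A} (hy : y ∈ lower F g k) : g j * y = y * g j := by
  induction hy using Algebra.adjoin_induction with
  | mem y hy =>
    obtain ⟨i, hi, rfl⟩ := hy
    exact (hg.comm i j (hk i hi) hj).symm
  | algebraMap c => exact (Algebra.commutes c _).symm
  | add a b _ _ ha hb => rw [mul_add, add_mul, ha, hb]
  | mul a b _ _ ha hb => rw [← mul_assoc, ha, mul_assoc, hb, mul_assoc]

/-- Under the reduction `hs`, the subspace `L + L g_k L` with `L = lower F g k` is stable under
right multiplication by the generators, so words with at most one `g k` span the next algebra. -/
theorem lower_succ_le (k : ℕ)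
    (hs : ∀ y ∈ lower F g k, ∃ y' ∈ lower F g k, g k * y * g k = y' * g k)
    (X : Submodule F A) (h0 : ∀ y ∈ lower F g k, y ∈ X)
    (h1 : ∀ y ∈ lower F g k, ∀ y' ∈ lower F g k, y * g k * y' ∈ X) :
    ∀ y ∈ lower F g (k + 1), y ∈ X := by
  set R : Submodule F A := Subalgebra.toSubmodule (lower F g k) ⊔
    Submodule.span F {z | ∃ a ∈ lower F g k, ∃ b ∈ lower F g k, z = a * g k * b} with hR
  have hRX : R ≤ X := by
    rw [hR]
    refine sup_le (fun y hy => h0 y hy) (Submodule.span_le.2 ?_)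
    rintro _ ⟨a, ha, b, hb, rfl⟩
    exact h1 a ha b hb
  have hl : ∀ a ∈ lower F g k, a ∈ R := fun a ha => Submodule.mem_sup_left ha
  have hr : ∀ a ∈ lower F g k, ∀ b ∈ lower F g k, a * g k * b ∈ R := fun a ha b hb =>
    Submodule.mem_sup_right (Submodule.subset_span ⟨a, ha, b, hb, rfl⟩)
  have hind : ∀ (y : A) (Y : Submodule F A), (∀ a ∈ lower F g k, a * y ∈ Y) →
      (∀ a ∈ lower F g k, ∀ b ∈ lower F g k, a * g k * b * y ∈ Y) → ∀ t ∈ R, t * y ∈ Y := by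
    intro y Y ha hb
    have : R ≤ Y.comap (LinearMap.mulRight F y) := by
      rw [hR]
      refine sup_le (fun a h => ha a h) (Submodule.span_le.2 ?_)
      rintro _ ⟨a, h, b, h', rfl⟩
      exact hb a h b h'
    exact fun t ht => this ht
  intro y hy
  apply hRX
  -- Stability of `R` under right multiplication, proved for all `t` at once, is what survives
  -- products in the induction on `y`.
  suffices ∀ t ∈ R, t * y ∈ R by simpa using this 1 (hl 1 (one_mem _))
  induction hy using Algebra.adjoin_induction with
  | mem y hy =>
    obtain ⟨i, hi, rfl⟩ := hy
    rcases Nat.lt_succ_iff_lt_or_eq.1 hi with hi | rfl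
    · refine hind _ _ (fun a ha => hl _ (mul_mem ha (mem_lower g hi))) fun a ha b hb => ?_
      rw [mul_assoc]
      exact hr a ha _ (mul_mem hb (mem_lower g hi))
    · refine hind _ _ (fun a ha => by simpa using hr a ha 1 (one_mem _)) fun a ha b hb => ?_
      obtain ⟨y', hy', h⟩ := hs b hb
      have : a * g i * b * g i = (a * y') * g i * 1 := by
        rw [mul_assoc, mul_assoc, ← mul_assoc (g i), h, mul_one, mul_assoc]
      rw [this]
      exact hr _ (mul_mem ha hy') _ (one_mem _)
  | algebraMap c =>
    intro t ht
    rw [← Algebra.commutes, ← Algebra.smul_def]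
    exact R.smul_mem c ht
  | add a b _ _ ha hb => exact fun t ht => by rw [mul_add]; exact R.add_mem (ha t ht) (hb t ht)
  | mul a b _ _ ha hb => exact fun t ht => by rw [← mul_assoc]; exact hb _ (ha t ht)

/-- Jones's reduction. By induction `y` contains at most one `g (k - 1)`. If it contains none, `y`
commutes with `g k` and a factor `x` comes out; if it contains one, the cubic relation removes it.
-/
theorem IsTLSeq.sandwich_lower (hg : IsTLSeq x g N) (k : ℕ) (hk : k < N) :
    ∀ y ∈ lower F g k, ∃ y' ∈ lower F g (k - 1), g k * y * g k = y' * g k := by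
  induction k with
  | zero =>
    intro y hy
    have : y ∈ (⊥ : Subalgebra F A) := by simpa [lower] using hy
    obtain ⟨c, rfl⟩ := Algebra.mem_bot.1 this
    refine ⟨algebraMap F A (c * x), Subalgebra.algebraMap_mem _ _, ?_⟩
    rw [← Algebra.commutes, mul_assoc, hg.sq 0 hk, ← Algebra.smul_def, ← Algebra.smul_def,
      smul_smul]
  | succ k ih =>
    have ih := ih (by omega)
    set X : Submodule F A := (Submodule.map (LinearMap.mulRight F (g (k + 1)))
      (Subalgebra.toSubmodule (lower F g k))).comap
        (LinearMap.mulRight F (g (k + 1)) ∘ₗ LinearMap.mulLeft F (g (k + 1))) with hX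
    have key : ∀ y ∈ lower F g (k + 1), y ∈ X := by
      refine lower_succ_le k
        (fun y hy => (ih y hy).imp fun y' h => ⟨lower_mono g (by omega) h.1, h.2⟩) X ?_ ?_
      · intro y hy
        refine ⟨x • y, Subalgebra.smul_mem _ hy x, ?_⟩
        simp only [LinearMap.mulRight_apply, LinearMap.comp_apply, LinearMap.mulLeft_apply]
        rw [hg.commute_lower (by omega) hk hy, mul_assoc, hg.sq _ hk, smul_mul_assoc,
          mul_smul_comm]
      · intro a ha b hb
        rcases hg.adj k hk with h | h
        · rw [h, mul_zero, zero_mul]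
          exact X.zero_mem
        · refine ⟨a * b, (lower F g k).mul_mem ha hb, ?_⟩
          simp only [LinearMap.mulRight_apply, LinearMap.comp_apply, LinearMap.mulLeft_apply]
          have h1 := hg.commute_lower (by omega) hk ha
          have h2 := hg.commute_lower (by omega) hk hb
          calc a * b * g (k + 1) = a * (g (k + 1) * b) := by rw [h2, mul_assoc]
            _ = a * (g (k + 1) * g k * g (k + 1) * b) := by rw [h]
            _ = (a * g (k + 1)) * g k * (g (k + 1) * b) := by simp only [mul_assoc]
            _ = (g (k + 1) * a) * g k * (b * g (k + 1)) := by rw [h1, h2]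
            _ = g (k + 1) * (a * g k * b) * g (k + 1) := by simp only [mul_assoc]
    intro y hy
    obtain ⟨y', hy', h⟩ := key y hy
    exact ⟨y', by simpa using hy', h.symm⟩

theorem IsTLSeq.lower_succ_induction (hg : IsTLSeq x g N) {k : ℕ} (hk : k < N)
    (X : Submodule F A) (h0 : ∀ y ∈ lower F g k, y ∈ X)
    (h1 : ∀ y ∈ lower F g k, ∀ y' ∈ lower F g k, y * g k * y' ∈ X) :
    ∀ y ∈ lower F g (k + 1), y ∈ X :=
  lower_succ_le k (fun y hy => (hg.sandwich_lower k hk y hy).imp fun y' h =>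
    ⟨lower_mono g (by omega) h.1, h.2⟩) X h0 h1

theorem IsTLSeq.sandwich (hg : IsTLSeq x g N) (k : ℕ) (hk : k < N) :
    ∀ y ∈ lower F g (k + 1), ∃ y' ∈ lower F g (k - 1), g k * y * g k = y' * g k := by
  set X : Submodule F A := (Submodule.map (LinearMap.mulRight F (g k))
    (Subalgebra.toSubmodule (lower F g (k - 1)))).comap
      (LinearMap.mulRight F (g k) ∘ₗ LinearMap.mulLeft F (g k)) with hX
  have key : ∀ y ∈ lower F g (k + 1), y ∈ X := by
    refine hg.lower_succ_induction hk X ?_ ?_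
    · intro y hy
      obtain ⟨y', hy', h⟩ := hg.sandwich_lower k hk y hy
      exact ⟨y', hy', h.symm⟩
    · intro a ha b hb
      obtain ⟨a', ha', h⟩ := hg.sandwich_lower k hk a ha
      obtain ⟨b', hb', h'⟩ := hg.sandwich_lower k hk b hb
      refine ⟨a' * b', (lower F g (k - 1)).mul_mem ha' hb', ?_⟩
      simp only [LinearMap.mulRight_apply, LinearMap.comp_apply, LinearMap.mulLeft_apply]
      calc a' * b' * g k = a' * (g k * b * g k) := by rw [h', mul_assoc]
        _ = (a' * g k) * b * g k := by simp only [mul_assoc]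
        _ = g k * (a * g k * b) * g k := by rw [← h]; simp only [mul_assoc]
  intro y hy
  obtain ⟨y', hy', h⟩ := key y hy
  exact ⟨y', hy', h.symm⟩

end Sequence

/-! ### Relations between the generators -/

section Generators

variable {F : Type*} [Field F] {x : F} {n : ℕ}

theorem e_of_lt {i : ℕ} (h : 1 ≤ i ∧ i < n) :
    e F x n i = TL.mk F x n (FreeAlgebra.ι F ⟨i, h⟩) := dif_pos h

theorem e_of_not {i : ℕ} (h : ¬ (1 ≤ i ∧ i < n)) : e F x n i = 0 := dif_neg h

theorem TL.mk_eq {a b : FreeAlgebra F (Gen n)} (h : Rel F x n a b) :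
    TL.mk F x n a = TL.mk F x n b := RingQuot.mkAlgHom_rel F h

theorem TL.mk_surjective : Function.Surjective (TL.mk F x n) :=
  RingQuot.mkAlgHom_surjective F (Rel F x n)

theorem e_zero : e F x n 0 = 0 := e_of_not (by omega)

theorem e_sq (i : ℕ) : e F x n i * e F x n i = x • e F x n i := by
  by_cases h : 1 ≤ i ∧ i < n
  · rw [e_of_lt h, ← map_mul, ← map_smul]
    exact TL.mk_eq (Rel.sq _)
  · rw [e_of_not h, mul_zero, smul_zero]

theorem e_adj_succ {i : ℕ} (hi : 1 ≤ i) (h : i + 1 < n) :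
    e F x n i * e F x n (i + 1) * e F x n i = e F x n i := by
  rw [e_of_lt (i := i) (by omega), e_of_lt (i := i + 1) (by omega), ← map_mul, ← map_mul]
  exact TL.mk_eq (Rel.adj _ _ (Or.inl rfl))

theorem e_succ_adj {i : ℕ} (hi : 1 ≤ i) (h : i + 1 < n) :
    e F x n (i + 1) * e F x n i * e F x n (i + 1) = e F x n (i + 1) := by
  rw [e_of_lt (i := i) (by omega), e_of_lt (i := i + 1) (by omega), ← map_mul, ← map_mul]
  exact TL.mk_eq (Rel.adj _ _ (Or.inr rfl))

theorem e_comm {i j : ℕ} (h : i + 2 ≤ j) : e F x n i * e F x n j = e F x n j * e F x n i := by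
  by_cases hi : 1 ≤ i ∧ i < n
  · by_cases hj : 1 ≤ j ∧ j < n
    · rw [e_of_lt hi, e_of_lt hj, ← map_mul, ← map_mul]
      exact TL.mk_eq (Rel.comm _ _ (Or.inl h))
    · rw [e_of_not hj, mul_zero, zero_mul]
  · rw [e_of_not hi, mul_zero, zero_mul]

theorem isTLSeq_e : IsTLSeq x (e F x n) n where
  sq i _ := e_sq i
  adj i h := by
    rcases Nat.eq_zero_or_pos i with rfl | hi
    · exact Or.inl e_zero
    · exact Or.inr (e_succ_adj hi h)
  comm i j h _ := e_comm h

/-- Reversing indices turns results on initial segments of generators into results on final ones.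
The spurious `e 0 = 0` now comes last, where the cubic relation reads `0 = 0`. -/
theorem isTLSeq_e_reverse {N : ℕ} (hN : N ≤ n) :
    IsTLSeq x (fun i => e F x n (N - 1 - i)) N where
  sq i _ := e_sq _
  adj i h := by
    right
    have h1 : N - 1 - i = (N - 1 - (i + 1)) + 1 := by omega
    rw [h1]
    rcases Nat.eq_zero_or_pos (N - 1 - (i + 1)) with h0 | hi
    · rw [h0, e_zero, mul_zero]
    · exact e_adj_succ hi (by omega)
  comm i j h hj := (e_comm (by omega)).symm

variable (F x n) in
/-- The subalgebra generated by the `e i` with `a ≤ i < b`. -/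
noncomputable def upper (a b : ℕ) : Subalgebra F (TL F x n) :=
  Algebra.adjoin F (e F x n '' Set.Ico a b)

theorem upper_sandwich {a N : ℕ} (ha : a < N) (hN : N ≤ n) {y : TL F x n}
    (hy : y ∈ upper F x n a N) :
    ∃ y' ∈ upper F x n (a + 2) N, e F x n a * y * e F x n a = e F x n a * y' := by
  have h1 : upper F x n a N ≤ lower F (fun i => e F x n (N - 1 - i)) (N - 1 - a + 1) := by
    refine Algebra.adjoin_mono ?_
    rintro _ ⟨i, hi, rfl⟩
    rw [Set.mem_Ico] at hi
    refine ⟨N - 1 - i, ?_, ?_⟩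
    · rw [Set.mem_Iio]; omega
    · simp only; congr 1; omega
  obtain ⟨y', hy', h⟩ := (isTLSeq_e_reverse hN).sandwich (N - 1 - a) (by omega) y (h1 hy)
  have h2 : N - 1 - (N - 1 - a) = a := by omega
  have h3 := (isTLSeq_e_reverse hN).commute_lower (j := N - 1 - a) (by omega) (by omega) hy'
  simp only [h2] at h h3
  refine ⟨y', Algebra.adjoin_mono ?_ hy', h.trans h3.symm⟩
  rintro _ ⟨i, hi, rfl⟩
  rw [Set.mem_Iio] at hi
  refine ⟨N - 1 - i, ?_, rfl⟩
  rw [Set.mem_Ico]; omega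

end Generators

/-! ### Spanning sets of the cell modules -/

/-- `s` is the sequence of first components of an infinite path of partitions. -/
def IsWalk (s : ℕ → ℕ) : Prop := ∀ k, 2 * s k ≤ k ∧ (s (k + 1) = s k ∨ s (k + 1) = s k + 1)

theorem IsWalk.mono {s : ℕ → ℕ} (hs : IsWalk s) : Monotone s :=
  monotone_nat_of_le_succ fun k => by have := (hs k).2; omega

section Span

variable (F : Type*) [Field F] (x : F) (n : ℕ)

/-- The product `e 1 * e 3 * ⋯ * e (2 f - 1)`. -/
noncomputable def oddProd (f : ℕ) : TL F x n :=
  ((List.range f).map (fun j => e F x n (2 * j + 1))).prod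

/-- The element `v` of the path of length `k` with first components `s`. -/
noncomputable def walkV (s : ℕ → ℕ) : ℕ → TL F x n
  | 0 => 1
  | k + 1 =>
    if s (k + 1) = s k then walkV s k
    else w F x n (2 * s (k + 1)) (k + 1) * walkV s k

/-- The element `v^*` of the path of length `k` with first components `s`. -/
noncomputable def walkVStar (s : ℕ → ℕ) : ℕ → TL F x n
  | 0 => 1
  | k + 1 =>
    if s (k + 1) = s k then walkVStar s k
    else walkVStar s k * w F x n (k + 1) (2 * s (k + 1))

/-- The span of the elements `m_λ v_t` for the paths `t` of length `k` with shape `(f, k - 2 f)`. -/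
noncomputable def murphySpan (k f : ℕ) : Submodule F (TL F x n) :=
  Submodule.span F {z | ∃ s, IsWalk s ∧ s k = f ∧ z = oddProd F x n f * walkV F x n s k}

/-- The two-sided ideal generated by `oddProd (f + 1)` in the subalgebra on `k` strands. -/
noncomputable def aboveSpan (k f : ℕ) : Submodule F (TL F x n) :=
  Submodule.span F {z | 2 * f + 2 ≤ k ∧ ∃ a ∈ lower F (e F x n) k, ∃ b ∈ lower F (e F x n) k,
    z = a * oddProd F x n (f + 1) * b}

variable {F x n}

/-! ### The products of odd generators. -/

theorem oddProd_zero : oddProd F x n 0 = 1 := by simp [oddProd]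

theorem oddProd_succ (f : ℕ) :
    oddProd F x n (f + 1) = oddProd F x n f * e F x n (2 * f + 1) := by
  simp [oddProd, List.range_succ]

theorem oddProd_comm_e {f j : ℕ} (h : 2 * f + 1 ≤ j) :
    oddProd F x n f * e F x n j = e F x n j * oddProd F x n f := by
  induction f with
  | zero => simp [oddProd_zero]
  | succ f ih =>
    rw [oddProd_succ, mul_assoc, e_comm (by omega), ← mul_assoc, ih (by omega), mul_assoc]

theorem oddProd_comm_upper {f a b : ℕ} (h : 2 * f + 1 ≤ a) {y : TL F x n}
    (hy : y ∈ upper F x n a b) : oddProd F x n f * y = y * oddProd F x n f := by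
  induction hy using Algebra.adjoin_induction with
  | mem y hy =>
    obtain ⟨i, hi, rfl⟩ := hy
    exact oddProd_comm_e (h.trans hi.1)
  | algebraMap c => exact (Algebra.commutes c _).symm
  | add a b _ _ ha hb => rw [mul_add, add_mul, ha, hb]
  | mul a b _ _ ha hb => rw [← mul_assoc, ha, mul_assoc, hb, mul_assoc]

theorem oddProd_sq (f : ℕ) :
    oddProd F x n f * oddProd F x n f = x ^ f • oddProd F x n f := by
  induction f with
  | zero => simp [oddProd_zero]
  | succ f ih =>
    calc oddProd F x n (f + 1) * oddProd F x n (f + 1)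
        = oddProd F x n f * (e F x n (2 * f + 1) * oddProd F x n f) * e F x n (2 * f + 1) := by
          rw [oddProd_succ]; simp only [mul_assoc]
      _ = (oddProd F x n f * oddProd F x n f) * (e F x n (2 * f + 1) * e F x n (2 * f + 1)) := by
          rw [← oddProd_comm_e le_rfl]; simp only [mul_assoc]
      _ = x ^ (f + 1) • oddProd F x n (f + 1) := by
          rw [ih, e_sq, oddProd_succ, smul_mul_assoc, mul_smul_comm, smul_smul, pow_succ]

theorem exists_oddProd_eq_mul_e {f i : ℕ} (h : i < f) :
    ∃ q, oddProd F x n f = q * e F x n (2 * i + 1) := by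
  induction f with
  | zero => omega
  | succ f ih =>
    rcases Nat.lt_succ_iff_lt_or_eq.1 h with h | rfl
    · obtain ⟨q, hq⟩ := ih h
      exact ⟨q * e F x n (2 * f + 1), by
        rw [oddProd_succ, hq, mul_assoc, e_comm (by omega), mul_assoc]⟩
    · exact ⟨_, oddProd_succ _⟩

theorem oddProd_mul_e_odd {f i : ℕ} (h : i < f) :
    oddProd F x n f * e F x n (2 * i + 1) = x • oddProd F x n f := by
  obtain ⟨q, hq⟩ := exists_oddProd_eq_mul_e (F := F) (x := x) (n := n) h
  rw [hq, mul_assoc, e_sq, mul_smul_comm]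

theorem oddProd_mul_e_even {f i : ℕ} (h : i < f) (hi : 1 ≤ i) (hn : 2 * f ≤ n) :
    oddProd F x n f * (e F x n (2 * i) * e F x n (2 * i + 1)) = oddProd F x n f := by
  obtain ⟨q, hq⟩ := exists_oddProd_eq_mul_e (F := F) (x := x) (n := n) h
  rw [hq, mul_assoc, ← mul_assoc (e F x n (2 * i + 1)), e_succ_adj (by omega) (by omega)]

/-! ### The words `w` and the subalgebras they lie in. -/

theorem w_of_le {a b : ℕ} (h : a ≤ b) :
    w F x n a b = ((List.range' a (b - a)).map (e F x n)).prod := by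
  unfold w
  rcases h.lt_or_eq with h | rfl
  · rw [if_pos h]
  · simp

theorem w_self (a : ℕ) : w F x n a a = 1 := by simp [w]

theorem w_succ_right {a b : ℕ} (h : a ≤ b) : w F x n a (b + 1) = w F x n a b * e F x n b := by
  rw [w_of_le h, w_of_le (by omega), Nat.succ_sub h, List.range'_concat]
  simp [Nat.add_sub_cancel' h]

theorem w_eq_e_mul {a b : ℕ} (h : a < b) : w F x n a b = e F x n a * w F x n (a + 1) b := by
  rw [w_of_le h.le, w_of_le h]
  obtain ⟨c, rfl⟩ := Nat.exists_eq_add_of_lt h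
  have h1 : a + c + 1 - a = c + 1 := by omega
  have h2 : a + c + 1 - (a + 1) = c := by omega
  rw [h1, h2, List.range'_succ]
  simp

theorem w_mem_upper {a b : ℕ} (h : a ≤ b) : w F x n a b ∈ upper F x n a b := by
  rw [w_of_le h]
  refine list_prod_mem fun y hy => ?_
  obtain ⟨i, hi, rfl⟩ := List.mem_map.1 hy
  rw [List.mem_range'_1] at hi
  exact Algebra.subset_adjoin ⟨i, ⟨hi.1, by omega⟩, rfl⟩

theorem upper_le_lower (a b : ℕ) : upper F x n a b ≤ lower F (e F x n) b :=
  Algebra.adjoin_mono (Set.image_mono fun _ h => h.2)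

theorem lower_le_upper (b : ℕ) : lower F (e F x n) b ≤ upper F x n 1 b := by
  refine Algebra.adjoin_le ?_
  rintro _ ⟨i, hi, rfl⟩
  rcases Nat.eq_zero_or_pos i with rfl | h
  · rw [e_zero]; exact zero_mem _
  · exact Algebra.subset_adjoin ⟨i, ⟨h, hi⟩, rfl⟩

theorem lower_eq_top : lower F (e F x n) n = ⊤ := by
  rw [eq_top_iff]
  rintro y -
  obtain ⟨y, rfl⟩ := TL.mk_surjective y
  induction y using FreeAlgebra.induction with
  | grade0 r => rw [AlgHom.commutes]; exact Subalgebra.algebraMap_mem _ _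
  | grade1 i => rw [← e_of_lt]; exact mem_lower _ i.2.2
  | mul a b ha hb => rw [map_mul]; exact mul_mem ha hb
  | add a b ha hb => rw [map_add]; exact add_mem ha hb

/-- Sandwiching by one odd generator at a time: `e (2 * f + 1)` commutes with `oddProd f`, and each
use of `upper_sandwich` moves the lower end of the window by two. -/
theorem oddProd_sandwich {f N : ℕ} (hf : 2 * f ≤ N) (hN : N ≤ n) {y : TL F x n}
    (hy : y ∈ lower F (e F x n) N) :
    ∃ y' ∈ upper F x n (2 * f + 1) N, oddProd F x n f * y * oddProd F x n f =
      oddProd F x n f * y' := by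
  induction f with
  | zero => exact ⟨y, lower_le_upper _ hy, by simp [oddProd_zero]⟩
  | succ f ih =>
    obtain ⟨y', hy', h⟩ := ih (by omega)
    obtain ⟨y'', hy'', h'⟩ := upper_sandwich (by omega) hN hy'
    refine ⟨y'', hy'', ?_⟩
    calc oddProd F x n (f + 1) * y * oddProd F x n (f + 1)
        = e F x n (2 * f + 1) * (oddProd F x n f * y * oddProd F x n f) * e F x n (2 * f + 1) := by
          rw [oddProd_succ]; nth_rewrite 1 [oddProd_comm_e le_rfl]; simp only [mul_assoc]
      _ = oddProd F x n f * (e F x n (2 * f + 1) * y' * e F x n (2 * f + 1)) := by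
          rw [h, ← mul_assoc, ← oddProd_comm_e le_rfl]; simp only [mul_assoc]
      _ = oddProd F x n (f + 1) * y'' := by rw [h', oddProd_succ]; simp only [mul_assoc]

/-! ### Working modulo more dominant shapes. -/

theorem aboveSpan_mul_mem {k f : ℕ} {y b : TL F x n} (hy : y ∈ aboveSpan F x n k f)
    (hb : b ∈ lower F (e F x n) k) : y * b ∈ aboveSpan F x n k f := by
  have : aboveSpan F x n k f ≤ (aboveSpan F x n k f).comap (LinearMap.mulRight F b) := by
    refine Submodule.span_le.2 ?_
    rintro _ ⟨h, a, ha, c, hc, rfl⟩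
    refine Submodule.subset_span ⟨h, a, ha, c * b, mul_mem hc hb, ?_⟩
    simp [mul_assoc]
  exact this hy

theorem mul_aboveSpan_mem {k f : ℕ} {y b : TL F x n} (hy : y ∈ aboveSpan F x n k f)
    (hb : b ∈ lower F (e F x n) k) : b * y ∈ aboveSpan F x n k f := by
  have : aboveSpan F x n k f ≤ (aboveSpan F x n k f).comap (LinearMap.mulLeft F b) := by
    refine Submodule.span_le.2 ?_
    rintro _ ⟨h, a, ha, c, hc, rfl⟩
    refine Submodule.subset_span ⟨h, b * a, mul_mem hb ha, c, hc, ?_⟩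
    simp [mul_assoc]
  exact this hy

theorem aboveSpan_mono {j k : ℕ} (f : ℕ) (h : j ≤ k) :
    aboveSpan F x n j f ≤ aboveSpan F x n k f := by
  refine Submodule.span_mono ?_
  rintro _ ⟨h', a, ha, c, hc, rfl⟩
  exact ⟨h'.trans h, a, lower_mono _ h ha, c, lower_mono _ h hc, rfl⟩

/-- For `j = 2 * f + 1` the product is `oddProd (f + 1)` itself; later generators are reached
through `e (j + 1) * e j * e (j + 1) = e (j + 1)`, the outer factors commuting with `oddProd f`. -/
theorem oddProd_mul_e_mem_aboveSpan {f j k : ℕ} (hj : 2 * f < j) (hk : j < k) (hn : k ≤ n) :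
    oddProd F x n f * e F x n j ∈ aboveSpan F x n k f := by
  induction j, hj using Nat.le_induction with
  | base =>
    exact Submodule.subset_span ⟨by omega, 1, one_mem _, 1, one_mem _, by
      rw [oddProd_succ, one_mul, mul_one]⟩
  | succ j hj ih =>
    have h : oddProd F x n f * e F x n (j + 1) =
        e F x n (j + 1) * (oddProd F x n f * e F x n j) * e F x n (j + 1) := by
      rw [← mul_assoc, ← oddProd_comm_e (by omega)]
      nth_rewrite 1 [← e_succ_adj (by omega) (by omega)]
      simp only [mul_assoc]
    rw [h]
    exact aboveSpan_mul_mem (mul_aboveSpan_mem (ih (by omega)) (mem_lower _ hk)) (mem_lower _ hk)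

/-- Every generator of this subalgebra is absorbed by the ideal, so only the constant term of `y`
survives. -/
theorem oddProd_mul_upper_mem {f k : ℕ} (hn : k ≤ n) {y : TL F x n}
    (hy : y ∈ upper F x n (2 * f + 1) k) :
    ∃ c : F, oddProd F x n f * y - c • oddProd F x n f ∈ aboveSpan F x n k f := by
  induction hy using Algebra.adjoin_induction with
  | mem y hy =>
    obtain ⟨i, hi, rfl⟩ := hy
    rw [Set.mem_Ico] at hi
    exact ⟨0, by simpa using oddProd_mul_e_mem_aboveSpan (by omega) hi.2 hn⟩
  | algebraMap c =>
    refine ⟨c, ?_⟩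
    rw [← Algebra.commutes, ← Algebra.smul_def, sub_self]
    exact zero_mem _
  | add a b _ _ ha hb =>
    obtain ⟨c, ha⟩ := ha
    obtain ⟨d, hb⟩ := hb
    refine ⟨c + d, ?_⟩
    convert add_mem ha hb using 1
    rw [mul_add, add_smul]; abel
  | mul a b _ hb' ha hb =>
    obtain ⟨c, ha⟩ := ha
    obtain ⟨d, hb⟩ := hb
    refine ⟨c * d, ?_⟩
    convert add_mem (aboveSpan_mul_mem ha (upper_le_lower _ _ hb')) (Submodule.smul_mem _ c hb)
      using 1
    rw [sub_mul, smul_sub, smul_smul, smul_mul_assoc, mul_assoc]; abel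

theorem oddProd_sandwich_mem {f N : ℕ} (hf : 2 * f ≤ N) (hN : N ≤ n) {y : TL F x n}
    (hy : y ∈ lower F (e F x n) N) :
    ∃ c : F, oddProd F x n f * y * oddProd F x n f - c • oddProd F x n f ∈
      aboveSpan F x n N f := by
  obtain ⟨y', hy', h⟩ := oddProd_sandwich hf hN hy
  rw [h]
  exact oddProd_mul_upper_mem hN hy'

/-- An odd leading letter of the word is absorbed at the cost of `x`, and a pair `e (2 * i) * e (2 *
i + 1)` is absorbed for free. Hence all words starting at `j ≤ 2 * f` reduce to the single word
occurring in Murphy elements. -/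
theorem oddProd_mul_w {f k : ℕ} (hk : 2 * f ≤ k) (hn : k ≤ n) (d j : ℕ) (hj : 1 ≤ j)
    (h : j + d = 2 * f) :
    ∃ c : F, oddProd F x n f * w F x n j k = c • (oddProd F x n f * w F x n (2 * f) k) := by
  induction d using Nat.strong_induction_on generalizing j with
  | _ d ih =>
    rcases Nat.eq_zero_or_pos d with rfl | hd
    · exact ⟨1, by rw [one_smul, ← h, add_zero]⟩
    rcases Nat.even_or_odd' j with ⟨i, rfl | rfl⟩
    · obtain ⟨c, hc⟩ := ih (d - 2) (by omega) (2 * i + 2) (by omega) (by omega)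
      refine ⟨c, ?_⟩
      rw [w_eq_e_mul (by omega), w_eq_e_mul (by omega), ← mul_assoc (e F x n (2 * i)), ← mul_assoc,
        oddProd_mul_e_even (by omega) (by omega) (by omega), hc]
    · obtain ⟨c, hc⟩ := ih (d - 1) (by omega) (2 * i + 2) (by omega) (by omega)
      refine ⟨x * c, ?_⟩
      rw [w_eq_e_mul (by omega), ← mul_assoc, oddProd_mul_e_odd (by omega), smul_mul_assoc, hc,
        smul_smul]

/-- Coset normal form: in `y * e k * y'`, the factor `y` is by induction a word `w j k`, or nothing,
times an element that commutes with `e k` and can be moved into `y'`. -/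
theorem lower_succ_w_induction {k : ℕ} (hk : k + 1 ≤ n) (X : Submodule F (TL F x n))
    (h0 : ∀ y ∈ lower F (e F x n) k, y ∈ X)
    (h1 : ∀ j, 1 ≤ j → j ≤ k → ∀ y ∈ lower F (e F x n) k, w F x n j (k + 1) * y ∈ X) :
    ∀ y ∈ lower F (e F x n) (k + 1), y ∈ X := by
  induction k generalizing X with
  | zero =>
    refine isTLSeq_e.lower_succ_induction hk X h0 fun y _ y' _ => ?_
    rw [e_zero, mul_zero, zero_mul]
    exact zero_mem _
  | succ k ih =>
    refine isTLSeq_e.lower_succ_induction hk X h0 fun y hy y' hy' => ?_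
    let Y : Submodule F (TL F x n) :=
      X.comap (LinearMap.mulRight F y' ∘ₗ LinearMap.mulRight F (e F x n (k + 1)))
    have hc : ∀ a ∈ lower F (e F x n) k, e F x n (k + 1) * a = a * e F x n (k + 1) := fun a ha =>
      isTLSeq_e.commute_lower (by omega) (by omega) ha
    refine ih (by omega) Y (fun a ha => ?_) (fun j hj hj' a ha => ?_) y hy
    · have h := h1 (k + 1) (by omega) le_rfl (a * y') (mul_mem (lower_mono _ (by omega) ha) hy')
      rw [w_succ_right le_rfl, w_self, one_mul, ← mul_assoc, hc a ha] at h
      exact h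
    · have h := h1 j hj (by omega) (a * y') (mul_mem (lower_mono _ (by omega) ha) hy')
      rw [w_succ_right (by omega), ← mul_assoc, mul_assoc (w F x n j (k + 1)), hc a ha,
        ← mul_assoc] at h
      exact h

theorem walkV_congr {s t : ℕ → ℕ} {k : ℕ} (h : ∀ i ≤ k, s i = t i) :
    walkV F x n s k = walkV F x n t k := by
  induction k with
  | zero => rfl
  | succ k ih =>
    rw [walkV, walkV, ih fun i hi => h i (by omega), h _ le_rfl, h k (by omega)]

/-- Follow `s` up to `k` and take the value `c` afterwards. -/
def stopAt (s : ℕ → ℕ) (k c : ℕ) : ℕ → ℕ := fun i => if i ≤ k then s i else c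

theorem IsWalk.stopAt {s : ℕ → ℕ} (hs : IsWalk s) {k c : ℕ} (hc : 2 * c ≤ k + 1)
    (h : c = s k ∨ c = s k + 1) : IsWalk (stopAt s k c) := by
  intro i
  have h1 := hs i
  simp only [TemperleyLieb.stopAt]
  rcases lt_trichotomy i k with hi | rfl | hi
  · rw [if_pos hi.le, if_pos (by omega)]; exact h1
  · rw [if_pos le_rfl, if_neg (by omega)]; exact ⟨h1.1, h⟩
  · rw [if_neg (by omega), if_neg (by omega)]; exact ⟨by omega, Or.inl rfl⟩

theorem murphySpan_le_succ (k f : ℕ) : murphySpan F x n k f ≤ murphySpan F x n (k + 1) f := by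
  refine Submodule.span_le.2 ?_
  rintro _ ⟨s, hs, rfl, rfl⟩
  have h1 : stopAt s k (s k) (k + 1) = s k := by simp [stopAt]
  have h2 : stopAt s k (s k) k = s k := by simp [stopAt]
  refine Submodule.subset_span ⟨stopAt s k (s k), hs.stopAt (by have := (hs k).1; omega)
    (Or.inl rfl), h1, ?_⟩
  rw [walkV, h1, h2, if_pos rfl]
  congr 1
  exact walkV_congr fun i hi => by simp [stopAt, hi]

/-- The last factor `e (2 * f + 1)` lengthens the word and the rest commutes past it. This passes
from `f + 1` to `f` and drives the spanning induction. -/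
theorem oddProd_succ_mul_w {f k : ℕ} (h : 2 * f + 2 ≤ k) :
    oddProd F x n (f + 1) * w F x n (2 * (f + 1)) k =
      w F x n (2 * f + 1) k * oddProd F x n f := by
  rw [← oddProd_comm_upper le_rfl (w_mem_upper (by omega)), oddProd_succ, mul_assoc,
    w_eq_e_mul (a := 2 * f + 1) (by omega)]
  rfl

theorem w_mul_murphySpan_mem {k f : ℕ} (hf : 2 * f + 2 ≤ k + 1) {y : TL F x n}
    (hy : y ∈ murphySpan F x n k f) :
    w F x n (2 * f + 1) (k + 1) * y ∈ murphySpan F x n (k + 1) (f + 1) := by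
  have : murphySpan F x n k f ≤ (murphySpan F x n (k + 1) (f + 1)).comap
      (LinearMap.mulLeft F (w F x n (2 * f + 1) (k + 1))) := by
    refine Submodule.span_le.2 ?_
    rintro _ ⟨s, hs, rfl, rfl⟩
    have h1 : stopAt s k (s k + 1) (k + 1) = s k + 1 := by simp [stopAt]
    have h2 : stopAt s k (s k + 1) k = s k := by simp [stopAt]
    refine Submodule.subset_span ⟨stopAt s k (s k + 1), hs.stopAt (by omega) (Or.inr rfl), h1, ?_⟩
    rw [walkV, h1, h2, if_neg (by omega), LinearMap.mulLeft_apply, ← mul_assoc, ← mul_assoc,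
      oddProd_succ_mul_w hf]
    congr 1
    exact walkV_congr fun i hi => by simp [stopAt, hi]
  exact this hy

theorem oddProd_mul_murphySpan {k f : ℕ} {y : TL F x n} (hy : y ∈ murphySpan F x n k f) :
    oddProd F x n f * y = x ^ f • y := by
  induction hy using Submodule.span_induction with
  | mem y hy =>
    obtain ⟨s, hs, rfl, rfl⟩ := hy
    rw [← mul_assoc, oddProd_sq, smul_mul_assoc]
  | zero => simp
  | add a b _ _ ha hb => rw [mul_add, ha, hb, smul_add]
  | smul c a _ ha => rw [mul_smul_comm, ha, smul_comm]

/-- Induction on the number of strands through the coset words `w j (k + 1)`. Words with `j > 2 * f`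
fall into the ideal; the others reduce to `j = 2 * f`, where `oddProd_succ_mul_w` leaves one odd
generator fewer on one strand fewer. -/
theorem oddProd_mul_mem (hx : x ≠ 0) {k : ℕ} (hk : k ≤ n) {f : ℕ} (hf : 2 * f ≤ k) :
    ∀ y ∈ lower F (e F x n) k,
      oddProd F x n f * y ∈ murphySpan F x n k f ⊔ aboveSpan F x n k f := by
  induction k generalizing f with
  | zero =>
    intro y hy
    obtain rfl : f = 0 := by omega
    have : y ∈ (⊥ : Subalgebra F (TL F x n)) := by simpa [lower] using hy
    obtain ⟨c, rfl⟩ := Algebra.mem_bot.1 this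
    refine Submodule.mem_sup_left ?_
    rw [← Algebra.commutes, ← Algebra.smul_def]
    refine Submodule.smul_mem _ _ (Submodule.subset_span ⟨fun _ => 0, fun k => ?_, rfl, ?_⟩)
    · simp
    · simp [walkV]
  | succ k ih =>
    set X := murphySpan F x n (k + 1) f ⊔ aboveSpan F x n (k + 1) f with hX
    have ha : 2 * f ≤ k → ∀ y ∈ lower F (e F x n) k, oddProd F x n f * y ∈ X := fun h y hy =>
      sup_le_sup (murphySpan_le_succ k f) (aboveSpan_mono f (by omega)) (ih (by omega) h y hy)
    have hb : 1 ≤ f → ∀ y ∈ lower F (e F x n) k,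
        oddProd F x n f * w F x n (2 * f) (k + 1) * y ∈ X := by
      intro h1 y hy
      obtain ⟨f, rfl⟩ : ∃ f', f = f' + 1 := ⟨f - 1, by omega⟩
      -- The spare factor `oddProd f` is what controls the ideal part of the induction hypothesis:
      -- with it the word becomes `oddProd (f + 1) * w`, so a further `oddProd (f + 1)` on the right
      -- completes a sandwich, which reduces to a scalar.
      have key : murphySpan F x n k f ⊔ aboveSpan F x n k f ≤ X.comap
          (LinearMap.mulLeft F (w F x n (2 * f + 1) (k + 1) * oddProd F x n f)) := by
        refine sup_le (fun u hu => ?_) (Submodule.span_le.2 ?_)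
        · rw [Submodule.mem_comap, LinearMap.mulLeft_apply, mul_assoc, oddProd_mul_murphySpan hu,
            mul_smul_comm]
          exact Submodule.mem_sup_left (Submodule.smul_mem _ _ (w_mul_murphySpan_mem (by omega) hu))
        · rintro _ ⟨h2, a, ha', b, hb, rfl⟩
          rw [SetLike.mem_coe, Submodule.mem_comap, LinearMap.mulLeft_apply,
            ← oddProd_succ_mul_w (by omega), ← mul_assoc, ← mul_assoc,
            mul_assoc (oddProd F x n (f + 1))]
          obtain ⟨c, hc⟩ := oddProd_sandwich_mem (f := f + 1) hf hk
            (mul_mem (upper_le_lower _ _ (w_mem_upper (by omega))) (lower_mono _ (by omega) ha'))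
          have := add_mem (Submodule.mem_sup_right (aboveSpan_mul_mem hc
            (lower_mono _ (by omega) hb))) (X.smul_mem c (ha h2 b hb))
          rwa [sub_mul, smul_mul_assoc, sub_add_cancel] at this
      -- The spare factor contributes `x ^ f`, which is cancelled; this is where `x ≠ 0` enters.
      have h2 := key (ih (by omega) (by omega) y hy)
      rw [Submodule.mem_comap, LinearMap.mulLeft_apply, mul_assoc, ← mul_assoc (oddProd F x n f),
        oddProd_sq, smul_mul_assoc, mul_smul_comm, ← mul_assoc,
        ← oddProd_succ_mul_w (by omega)] at h2
      exact (X.smul_mem_iff (pow_ne_zero f hx)).1 h2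
    refine lower_succ_w_induction hk (X.comap (LinearMap.mulLeft F (oddProd F x n f))) ?_ ?_
    · intro y hy
      rw [Submodule.mem_comap, LinearMap.mulLeft_apply]
      rcases Nat.lt_or_ge k (2 * f) with h | h
      -- Here shape `f` does not fit on `k` strands, but the word `w (2 * f) (k + 1)` is empty, so
      -- `hb` applies.
      · have h1 : 2 * f = k + 1 := by omega
        have := hb (by omega) y hy
        rwa [h1, w_self, mul_one] at this
      · exact ha h y hy
    · intro j hj hjk y hy
      rw [Submodule.mem_comap, LinearMap.mulLeft_apply, ← mul_assoc]
      rcases Nat.lt_or_ge (2 * f) j with h | h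
      · rw [w_eq_e_mul (by omega), ← mul_assoc]
        refine Submodule.mem_sup_right (aboveSpan_mul_mem (aboveSpan_mul_mem
          (oddProd_mul_e_mem_aboveSpan h (by omega) hk) ?_) (lower_mono _ (by omega) hy))
        exact upper_le_lower _ _ (w_mem_upper (by omega))
      · obtain ⟨c, hc⟩ := oddProd_mul_w (F := F) (x := x) hf hk (2 * f - j) j hj (by omega)
        rw [hc, smul_mul_assoc]
        exact X.smul_mem c (hb (by omega) y hy)

end Span

/-! ### The path representation -/

section Rep

variable {F : Type*} [Field F] (x : F)

open Classical in
/-- The operator by which `e (j + 1)` acts on functions on infinite paths. -/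
noncomputable def stepOp (j : ℕ) : Module.End F ((ℕ → ℕ) → F) where
  toFun φ g :=
    if IsWalk g ∧ g (j + 2) = g j + 1 then
      (p F x (j - 2 * g j + 2) * φ (Function.update g (j + 1) (g j)) +
        p F x (j - 2 * g j) * φ (Function.update g (j + 1) (g j + 1))) / p F x (j - 2 * g j + 1)
    else 0
  map_add' φ ψ := by
    funext g
    simp only [Pi.add_apply]
    split_ifs
    · ring
    · simp
  map_smul' c φ := by
    funext g
    simp only [Pi.smul_apply, smul_eq_mul, RingHom.id_apply]
    split_ifs
    · ring
    · simp

variable {x}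

theorem stepOp_corner {j : ℕ} {g : ℕ → ℕ} (hg : IsWalk g) (hc : g (j + 2) = g j + 1)
    (φ : (ℕ → ℕ) → F) : stepOp x j φ g =
      (p F x (j - 2 * g j + 2) * φ (Function.update g (j + 1) (g j)) +
        p F x (j - 2 * g j) * φ (Function.update g (j + 1) (g j + 1))) / p F x (j - 2 * g j + 1) :=
  if_pos ⟨hg, hc⟩

theorem stepOp_of_not_corner {j : ℕ} {g : ℕ → ℕ} (hc : g (j + 2) ≠ g j + 1)
    (φ : (ℕ → ℕ) → F) : stepOp x j φ g = 0 :=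
  if_neg fun h => hc h.2

theorem stepOp_of_not_isWalk {j : ℕ} {g : ℕ → ℕ} (hg : ¬ IsWalk g)
    (φ : (ℕ → ℕ) → F) : stepOp x j φ g = 0 :=
  if_neg fun h => hg h.1

theorem IsWalk.update {j : ℕ} {g : ℕ → ℕ} (hg : IsWalk g) (hc : g (j + 2) = g j + 1) {b : ℕ}
    (hb : b = g j ∨ b = g j + 1) (hj : 2 * b ≤ j + 1) : IsWalk (Function.update g (j + 1) b) := by
  intro k
  have hk := hg k
  by_cases h1 : k = j + 1
  · subst h1
    rw [Function.update_self, Function.update_of_ne (by omega)]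
    exact ⟨by omega, by change g (j + 2) = b ∨ g (j + 2) = b + 1; omega⟩
  · rw [Function.update_of_ne h1]
    by_cases h2 : k = j
    · subst h2
      rw [Function.update_self]
      exact ⟨hk.1, hb⟩
    · rw [Function.update_of_ne (by omega)]
      exact hk

theorem IsWalk.update_low {j : ℕ} {g : ℕ → ℕ} (hg : IsWalk g) (hc : g (j + 2) = g j + 1) :
    IsWalk (Function.update g (j + 1) (g j)) :=
  hg.update hc (Or.inl rfl) (by have := (hg j).1; omega)

theorem IsWalk.update_high {j : ℕ} {g : ℕ → ℕ} (hg : IsWalk g) (hc : g (j + 2) = g j + 1)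
    (h : 2 * g j < j) : IsWalk (Function.update g (j + 1) (g j + 1)) :=
  hg.update hc (Or.inr rfl) (by omega)

/-- Only values on genuine walks matter: when `2 * g j = j` the upper way round the corner is not a
walk, but its coefficient is `p 0 = 0`. -/
theorem stepOp_congr {j : ℕ} {g : ℕ → ℕ} (hg : IsWalk g) {φ ψ : (ℕ → ℕ) → F}
    (hl : g (j + 2) = g j + 1 →
      φ (Function.update g (j + 1) (g j)) = ψ (Function.update g (j + 1) (g j)))
    (hh : g (j + 2) = g j + 1 → 2 * g j < j →
      φ (Function.update g (j + 1) (g j + 1)) = ψ (Function.update g (j + 1) (g j + 1))) :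
    stepOp x j φ g = stepOp x j ψ g := by
  by_cases hc : g (j + 2) = g j + 1
  · rw [stepOp_corner hg hc, stepOp_corner hg hc, hl hc]
    by_cases h : 2 * g j < j
    · rw [hh hc h]
    · have : j - 2 * g j = 0 := by omega
      rw [this]
      simp [p]
  · rw [stepOp_of_not_corner hc, stepOp_of_not_corner hc]

/-- The value of `stepOp` at a corner does not involve the middle coordinate `g (j + 1)`. -/
theorem stepOp_update {j : ℕ} {g : ℕ → ℕ} (hg : IsWalk g) (hc : g (j + 2) = g j + 1) {b : ℕ}
    (hw : IsWalk (Function.update g (j + 1) b)) (φ : (ℕ → ℕ) → F) :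
    stepOp x j φ (Function.update g (j + 1) b) = stepOp x j φ g := by
  have h0 : Function.update g (j + 1) b j = g j := Function.update_of_ne (by omega) _ _
  have h2 : Function.update g (j + 1) b (j + 2) = g (j + 2) :=
    Function.update_of_ne (by omega) _ _
  rw [stepOp_corner hw (by rw [h0, h2, hc]), stepOp_corner hg hc, h0, Function.update_idem,
    Function.update_idem]

/-! ### The Temperley–Lieb relations for the path operators. -/

variable (hp : ∀ i, p F x (i + 1) ≠ 0)
include hp

theorem stepOp_sq (j : ℕ) : stepOp x j * stepOp x j = x • stepOp x j := by
  ext φ g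
  rw [Module.End.mul_apply, LinearMap.smul_apply, Pi.smul_apply, smul_eq_mul]
  by_cases hg : IsWalk g
  · by_cases hc : g (j + 2) = g j + 1
    · rw [stepOp_congr (ψ := fun _ => stepOp x j φ g) hg
        (fun _ => stepOp_update hg hc (hg.update_low hc) φ)
        (fun _ h => stepOp_update hg hc (hg.update_high hc h) φ), stepOp_corner hg hc, ← add_mul,
        p_add_two]
      have := hp (j - 2 * g j)
      field_simp
      ring
    · simp [stepOp_of_not_corner hc]
  · simp [stepOp_of_not_isWalk hg]

/-- Of the four terms only one passes both corner conditions. Its two coefficients are inverse to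
each other, so the product acts as a substitution; the cubic relations and the third term in the
recursion for `T` rest on this and its mirror image. -/
theorem stepOp_mul_stepOp_succ {j : ℕ} {g : ℕ → ℕ} (hg : IsWalk g) (hc : g (j + 2) = g j + 1)
    {ψ : (ℕ → ℕ) → F} (hψ : ∀ g', g' (j + 2) ≠ g' j + 1 → ψ g' = 0) :
    stepOp x j (stepOp x (j + 1) ψ) g = ψ (Function.update g (j + 1) (g (j + 3) - 1)) := by
  have hw2 : g (j + 3) = g (j + 2) ∨ g (j + 3) = g (j + 2) + 1 := (hg (j + 2)).2
  have hb2 := (hg (j + 3)).1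
  have hb0 := (hg j).1
  have ev : ∀ b, IsWalk (Function.update g (j + 1) b) → g (j + 3) = b + 1 →
      stepOp x (j + 1) ψ (Function.update g (j + 1) b) =
        (p F x (j + 1 - 2 * b + 2) *
            ψ (Function.update (Function.update g (j + 1) b) (j + 2) b) +
          p F x (j + 1 - 2 * b) *
            ψ (Function.update (Function.update g (j + 1) b) (j + 2) (b + 1))) /
          p F x (j + 1 - 2 * b + 1) := by
    intro b hw h
    have h1 : Function.update g (j + 1) b (j + 1) = b := Function.update_self ..
    have h3 : Function.update g (j + 1) b (j + 1 + 2) = g (j + 3) :=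
      Function.update_of_ne (by omega) _ _
    rw [stepOp_corner hw (by rw [h1, h3, h]), h1]
  have ev0 : ∀ b, g (j + 3) ≠ b + 1 → stepOp x (j + 1) ψ (Function.update g (j + 1) b) = 0 := by
    intro b h
    apply stepOp_of_not_corner
    rw [Function.update_self, Function.update_of_ne (by omega)]
    exact h
  have up0 : ∀ b c, c ≠ g j + 1 →
      ψ (Function.update (Function.update g (j + 1) b) (j + 2) c) = 0 := by
    intro b c h
    apply hψ
    rw [Function.update_self, Function.update_of_ne (by omega), Function.update_of_ne (by omega)]
    exact h
  have up1 : ∀ b, Function.update (Function.update g (j + 1) b) (j + 2) (g j + 1) =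
      Function.update g (j + 1) b := by
    intro b
    rw [Function.update_eq_iff]
    exact ⟨by rw [Function.update_of_ne (by omega), hc], fun _ _ => rfl⟩
  rw [stepOp_corner hg hc]
  rcases hw2 with h | h
  · rw [ev _ (hg.update_low hc) (by omega), ev0 _ (by omega), up0 _ _ (by omega), up1,
      show g (j + 3) - 1 = g j by omega, show j + 1 - 2 * g j = j - 2 * g j + 1 by omega]
    have h1 := hp (j - 2 * g j)
    have h2 := hp (j - 2 * g j + 1)
    field_simp
    ring
  · rw [ev0 _ (by omega), ev _ (hg.update_high hc (by omega)) (by omega), up0 _ (g j + 1 + 1)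
      (by omega), up1, show g (j + 3) - 1 = g j + 1 by omega]
    obtain ⟨a, ha⟩ : ∃ a, j - 2 * g j = a + 1 := ⟨j - 2 * g j - 1, by omega⟩
    rw [ha, show j + 1 - 2 * (g j + 1) = a by omega]
    have h1 := hp a
    have h2 := hp (a + 1)
    field_simp
    ring

theorem stepOp_succ_mul_stepOp {j : ℕ} {g : ℕ → ℕ} (hg : IsWalk g)
    (hc : g (j + 3) = g (j + 1) + 1)
    {ψ : (ℕ → ℕ) → F} (hψ : ∀ g', g' (j + 3) ≠ g' (j + 1) + 1 → ψ g' = 0) :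
    stepOp x (j + 1) (stepOp x j ψ) g = ψ (Function.update g (j + 2) (g j + 1)) := by
  have hw2 := (hg j).2
  have hb0 := (hg j).1
  have hb1 := (hg (j + 1)).1
  have hb3 := (hg (j + 3)).1
  have ev : ∀ b, IsWalk (Function.update g (j + 2) b) → b = g j + 1 →
      stepOp x j ψ (Function.update g (j + 2) b) =
        (p F x (j - 2 * g j + 2) *
            ψ (Function.update (Function.update g (j + 2) b) (j + 1) (g j)) +
          p F x (j - 2 * g j) *
            ψ (Function.update (Function.update g (j + 2) b) (j + 1) (g j + 1))) /
          p F x (j - 2 * g j + 1) := by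
    intro b hw h
    have h1 : Function.update g (j + 2) b (j + 2) = b := Function.update_self ..
    have h3 : Function.update g (j + 2) b j = g j := Function.update_of_ne (by omega) _ _
    rw [stepOp_corner hw (by rw [h1, h3, h]), h3]
  have ev0 : ∀ b, b ≠ g j + 1 → stepOp x j ψ (Function.update g (j + 2) b) = 0 := by
    intro b h
    apply stepOp_of_not_corner
    rw [Function.update_self, Function.update_of_ne (by omega)]
    exact h
  have up0 : ∀ b c, c ≠ g (j + 1) →
      ψ (Function.update (Function.update g (j + 2) b) (j + 1) c) = 0 := by
    intro b c h
    apply hψ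
    rw [Function.update_self, Function.update_of_ne (by omega), Function.update_of_ne (by omega)]
    omega
  have up1 : ∀ b c, c = g (j + 1) → Function.update (Function.update g (j + 2) b) (j + 1) c =
      Function.update g (j + 2) b := by
    intro b c h
    rw [Function.update_eq_iff]
    exact ⟨by rw [Function.update_of_ne (by omega), h], fun _ _ => rfl⟩
  rw [stepOp_corner hg hc]
  rcases hw2 with h | h
  · rw [ev _ (hg.update_high hc (by omega)) (by omega), ev0 _ (by omega), up0 _ (g j + 1) (by omega),
      up1 _ (g j) h.symm, h]
    obtain ⟨a, ha⟩ : ∃ a, j - 2 * g j = a := ⟨_, rfl⟩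
    rw [ha, show j + 1 - 2 * (g j) = a + 1 by omega]
    have h1 := hp a
    have h2 := hp (a + 1)
    field_simp
    ring
  · rw [ev _ (hg.update_low hc) (by omega), ev0 _ (by omega), up0 _ (g j) (by omega),
      up1 _ (g j + 1) h.symm, h]
    obtain ⟨a, ha⟩ : ∃ a, j - 2 * g j = a + 1 := ⟨j - 2 * g j - 1, by omega⟩
    rw [ha, show j + 1 - 2 * (g j + 1) = a by omega]
    have h1 := hp a
    have h2 := hp (a + 1)
    field_simp
    ring

theorem stepOp_adj (j : ℕ) : stepOp x j * stepOp x (j + 1) * stepOp x j = stepOp x j := by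
  ext φ g
  simp only [Module.End.mul_apply]
  by_cases hg : IsWalk g
  · by_cases hc : g (j + 2) = g j + 1
    · rw [stepOp_mul_stepOp_succ hp hg hc fun g' h => stepOp_of_not_corner h φ]
      have hw2 : g (j + 3) = g (j + 2) ∨ g (j + 3) = g (j + 2) + 1 := (hg (j + 2)).2
      have hb2 := (hg (j + 3)).1
      have hb0 := (hg j).1
      exact stepOp_update hg hc (hg.update hc (by omega) (by omega)) φ
    · rw [stepOp_of_not_corner hc, stepOp_of_not_corner hc]
  · rw [stepOp_of_not_isWalk hg, stepOp_of_not_isWalk hg]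

theorem stepOp_adj' (j : ℕ) :
    stepOp x (j + 1) * stepOp x j * stepOp x (j + 1) = stepOp x (j + 1) := by
  ext φ g
  simp only [Module.End.mul_apply]
  by_cases hg : IsWalk g
  · by_cases hc : g (j + 3) = g (j + 1) + 1
    · rw [stepOp_succ_mul_stepOp hp hg hc fun g' h => stepOp_of_not_corner h φ]
      have hw2 := (hg j).2
      have hb0 := (hg j).1
      exact stepOp_update hg hc (hg.update hc (by omega) (by omega)) φ
    · rw [stepOp_of_not_corner hc, stepOp_of_not_corner hc]
  · rw [stepOp_of_not_isWalk hg, stepOp_of_not_isWalk hg]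

omit hp in
theorem stepOp_comm {i j : ℕ} (h : i + 2 ≤ j) :
    stepOp x i * stepOp x j = stepOp x j * stepOp x i := by
  ext φ g
  simp only [Module.End.mul_apply]
  by_cases hg : IsWalk g
  swap
  · rw [stepOp_of_not_isWalk hg, stepOp_of_not_isWalk hg]
  have n1 : ∀ b, Function.update g (i + 1) b j = g j := fun b =>
    Function.update_of_ne (by omega) _ _
  have n2 : ∀ b, Function.update g (i + 1) b (j + 2) = g (j + 2) := fun b =>
    Function.update_of_ne (by omega) _ _
  have n3 : ∀ b, Function.update g (j + 1) b i = g i := fun b =>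
    Function.update_of_ne (by omega) _ _
  have n4 : ∀ b, Function.update g (j + 1) b (i + 2) = g (i + 2) := fun b =>
    Function.update_of_ne (by omega) _ _
  by_cases hi : g (i + 2) = g i + 1
  swap
  · rw [stepOp_of_not_corner hi, stepOp_congr (ψ := 0) hg, map_zero, Pi.zero_apply]
    · exact fun _ => stepOp_of_not_corner (by rwa [n3, n4]) φ
    · exact fun _ _ => stepOp_of_not_corner (by rwa [n3, n4]) φ
  by_cases hj : g (j + 2) = g j + 1
  swap
  · rw [stepOp_of_not_corner hj, stepOp_congr (ψ := 0) hg, map_zero, Pi.zero_apply]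
    · exact fun _ => stepOp_of_not_corner (by rwa [n1, n2]) φ
    · exact fun _ _ => stepOp_of_not_corner (by rwa [n1, n2]) φ
  -- At `i` and `j` at least two apart, neither move touches the data fixing the coefficients of the
  -- other, so these are frozen at `g`.
  set φi : (ℕ → ℕ) → F := fun g' =>
    (p F x (j - 2 * g j + 2) * φ (Function.update g' (j + 1) (g j)) +
        p F x (j - 2 * g j) * φ (Function.update g' (j + 1) (g j + 1))) / p F x (j - 2 * g j + 1)
    with hφi
  set φj : (ℕ → ℕ) → F := fun g' =>
    (p F x (i - 2 * g i + 2) * φ (Function.update g' (i + 1) (g i)) +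
        p F x (i - 2 * g i) * φ (Function.update g' (i + 1) (g i + 1))) / p F x (i - 2 * g i + 1)
    with hφj
  have ei : ∀ b, IsWalk (Function.update g (i + 1) b) →
      stepOp x j φ (Function.update g (i + 1) b) = φi (Function.update g (i + 1) b) := by
    intro b hw
    rw [stepOp_corner hw (by rw [n1, n2, hj]), hφi]
    simp only [n1]
  have ej : ∀ b, IsWalk (Function.update g (j + 1) b) →
      stepOp x i φ (Function.update g (j + 1) b) = φj (Function.update g (j + 1) b) := by
    intro b hw
    rw [stepOp_corner hw (by rw [n3, n4, hi]), hφj]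
    simp only [n3]
  rw [stepOp_congr (ψ := φi) hg (fun _ => ei _ (hg.update_low hi))
      (fun _ h => ei _ (hg.update_high hi h)),
    stepOp_congr (ψ := φj) hg (fun _ => ej _ (hg.update_low hj))
      (fun _ h => ej _ (hg.update_high hj h)), stepOp_corner hg hi, stepOp_corner hg hj, hφi, hφj]
  have hc : ∀ b c, Function.update (Function.update g (i + 1) b) (j + 1) c =
      Function.update (Function.update g (j + 1) c) (i + 1) b := fun b c =>
    Function.update_comm (by omega) _ _ _
  simp only [hc]
  ring

/-- The representation of the Temperley–Lieb algebra on functions on infinite paths. -/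
noncomputable def rep (n : ℕ) : TL F x n →ₐ[F] Module.End F ((ℕ → ℕ) → F) :=
  RingQuot.liftAlgHom F ⟨FreeAlgebra.lift F fun i : Gen n => stepOp x (i.1 - 1), by
    intro a b h
    induction h with
    | sq i => simp only [map_mul, map_smul, FreeAlgebra.lift_ι_apply]; exact stepOp_sq hp _
    | adj i j h =>
      simp only [map_mul, FreeAlgebra.lift_ι_apply]
      have hi := i.2.1
      have hj := j.2.1
      rcases h with h | h
      · rw [show j.1 - 1 = (i.1 - 1) + 1 by omega]
        exact stepOp_adj hp _
      · rw [show i.1 - 1 = (j.1 - 1) + 1 by omega]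
        exact stepOp_adj' hp _
    | comm i j h =>
      simp only [map_mul, FreeAlgebra.lift_ι_apply]
      have hi := i.2.1
      have hj := j.2.1
      rcases h with h | h
      · exact stepOp_comm (by omega)
      · exact (stepOp_comm (by omega)).symm⟩

theorem rep_e {n j : ℕ} (h : j + 1 < n) : rep hp n (e F x n (j + 1)) = stepOp x j := by
  rw [e_of_lt ⟨by omega, h⟩]
  refine (RingQuot.liftAlgHom_mkAlgHom_apply F (s := Rel F x n) _ _ _).trans ?_
  rw [FreeAlgebra.lift_ι_apply]
  rfl

theorem rep_mul_apply {n : ℕ} (a b : TL F x n) (φ : (ℕ → ℕ) → F) (g : ℕ → ℕ) :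
    rep hp n (a * b) φ g = rep hp n a (rep hp n b φ) g := by
  rw [map_mul, Module.End.mul_apply]

/-- Locality: the generators `e i` with `i < k` only alter coordinates below `k`. -/
theorem rep_eq_zero_of_lower {n k : ℕ} (hk : k ≤ n) {y : TL F x n}
    (hy : y ∈ lower F (e F x n) k) {φ : (ℕ → ℕ) → F} {g : ℕ → ℕ} (hg : IsWalk g)
    (h : ∀ g', IsWalk g' → (∀ i, k ≤ i → g' i = g i) → φ g' = 0) : rep hp n y φ g = 0 := by
  induction hy using Algebra.adjoin_induction generalizing φ g with
  | mem y hy =>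
    obtain ⟨i, hi, rfl⟩ := hy
    rw [Set.mem_Iio] at hi
    rcases i with _ | j
    · rw [e_zero]; simp
    · rw [rep_e hp (by omega), stepOp_congr (ψ := 0) hg, map_zero, Pi.zero_apply]
      · exact fun hc => h _ (hg.update_low hc) fun i hi => Function.update_of_ne (by omega) _ _
      · exact fun hc h' => h _ (hg.update_high hc h') fun i hi =>
          Function.update_of_ne (by omega) _ _
  | algebraMap c =>
    rw [AlgHom.commutes, Module.algebraMap_end_apply, Pi.smul_apply, h g hg fun _ _ => rfl,
      smul_zero]
  | add a b _ _ ha hb => rw [map_add, LinearMap.add_apply, Pi.add_apply, ha hg h, hb hg h, add_zero]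
  | mul a b _ _ ha hb =>
    rw [rep_mul_apply]
    exact ha hg fun g' hg' h' => hb hg' fun g'' hg'' h'' =>
      h g'' hg'' fun i hi => (h'' i hi).trans (h' i hi)

theorem rep_eq_zero {n : ℕ} (y : TL F x n) {φ : (ℕ → ℕ) → F} {g : ℕ → ℕ} (hg : IsWalk g)
    (h : ∀ g', IsWalk g' → (∀ i, n ≤ i → g' i = g i) → φ g' = 0) : rep hp n y φ g = 0 :=
  rep_eq_zero_of_lower hp le_rfl (by rw [lower_eq_top]; trivial) hg h

/-! ### The action of the Jucys–Murphy elements on paths -/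

/-- `y` acts on paths as multiplication by the function `c`. -/
def IsDiag {n : ℕ} (y : TL F x n) (c : (ℕ → ℕ) → F) : Prop :=
  ∀ φ g, IsWalk g → rep hp n y φ g = c g * φ g

omit hp in
variable (x) in
/-- The content `r_t(k)` in terms of the first components `g` of `t`. -/
def walkContent (g : ℕ → ℕ) (k : ℕ) : F :=
  if k ≤ 1 then 0
  else if g k = g (k - 1) + 1 then
    (p F x (g k) - x * p F x (g k - 1)) * p F x (k - g k + 1)
  else (p F x (k - g k + 1) - x * p F x (k - g k)) * p F x (g k)

omit hp in
variable (x) in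
/-- The value of `z_k` on a path with first components `g`. -/
def walkZ (g : ℕ → ℕ) (k : ℕ) : F := p F x (g k) * p F x (k - g k + 1)

omit hp in
theorem walkZ_eq {g : ℕ → ℕ} {k v d : ℕ} (h : g k = v) (h' : k = v + d) :
    walkZ x g k = p F x v * p F x (d + 1) := by
  rw [walkZ, h, h', Nat.add_sub_cancel_left]

omit hp in
-- Both branches of the content have this form, so the sum defining `z` telescopes.
theorem walkContent_succ {g : ℕ → ℕ} (hg : IsWalk g) (k : ℕ) :
    walkContent x g (k + 1) = walkZ x g (k + 1) - x * walkZ x g k := by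
  have h0 := (hg k).1
  have h1 := (hg (k + 1)).1
  rcases Nat.eq_zero_or_pos k with rfl | hk
  · rw [zero_add] at h1
    simp [walkContent, walkZ, show g 0 = 0 by omega, show g 1 = 0 by omega, p]
  · rw [walkContent, if_neg (by omega), Nat.add_sub_cancel]
    rcases (hg k).2 with h | h
    · rw [if_neg (by omega), walkZ, walkZ, h, show k + 1 - g k = k - g k + 1 by omega]
      ring
    · rw [if_pos h, walkZ, walkZ, h, Nat.add_sub_cancel,
        show k + 1 - (g k + 1) + 1 = k - g k + 1 by omega]
      ring

omit hp in
theorem walkZ_eq_sum {g : ℕ → ℕ} (hg : IsWalk g) (k : ℕ) :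
    ∑ i ∈ Finset.range (k + 1), x ^ i * walkContent x g (k - i) = walkZ x g k := by
  induction k with
  | zero => simp [walkContent, walkZ, show g 0 = 0 by have := (hg 0).1; omega, p]
  | succ k ih =>
    rw [Finset.sum_range_succ']
    have : ∀ i ∈ Finset.range (k + 1), x ^ (i + 1) * walkContent x g (k + 1 - (i + 1)) =
        x * (x ^ i * walkContent x g (k - i)) := by
      intro i _
      rw [Nat.add_sub_add_right]; ring
    rw [Finset.sum_congr rfl this, ← Finset.mul_sum, ih, Nat.sub_zero, walkContent_succ hg]
    ring

theorem IsDiag.sum {n : ℕ} {ι : Type*} (s : Finset ι) {y : ι → TL F x n}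
    {c : ι → (ℕ → ℕ) → F} (h : ∀ i ∈ s, IsDiag hp (y i) (c i)) :
    IsDiag hp (∑ i ∈ s, y i) (fun g => ∑ i ∈ s, c i g) := by
  intro φ g hg
  rw [map_sum, LinearMap.sum_apply, Finset.sum_apply, Finset.sum_mul]
  exact Finset.sum_congr rfl fun i hi => h i hi φ g hg

theorem IsDiag.smul {n : ℕ} {y : TL F x n} {c : (ℕ → ℕ) → F} (a : F) (h : IsDiag hp y c) :
    IsDiag hp (a • y) (fun g => a * c g) := by
  intro φ g hg
  rw [map_smul, LinearMap.smul_apply, Pi.smul_apply, h φ g hg, smul_eq_mul, mul_assoc]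

theorem IsDiag.mul {n : ℕ} {y y' : TL F x n} {c c' : (ℕ → ℕ) → F} (h : IsDiag hp y c)
    (h' : IsDiag hp y' c') : IsDiag hp (y * y') (fun g => c g * c' g) := by
  intro φ g hg
  rw [rep_mul_apply, h _ g hg, h' φ g hg, mul_assoc]

theorem IsDiag.one {n : ℕ} : IsDiag hp (1 : TL F x n) (fun _ => 1) := by
  intro φ g hg
  simp

theorem IsDiag.algebraMap {n : ℕ} (a : F) :
    IsDiag hp (algebraMap F (TL F x n) a) (fun _ => a) := by
  intro φ g hg
  rw [AlgHom.commutes, Module.algebraMap_end_apply, Pi.smul_apply, smul_eq_mul]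

theorem IsDiag.aeval {n : ℕ} {y : TL F x n} {c : (ℕ → ℕ) → F} (h : IsDiag hp y c) (q : F[X]) :
    IsDiag hp (aeval y q) (fun g => q.eval (c g)) := by
  induction q using Polynomial.induction_on with
  | C a => simpa using IsDiag.algebraMap hp a
  | add q q' hq hq' =>
    intro φ g hg
    rw [map_add, map_add, LinearMap.add_apply, Pi.add_apply, hq φ g hg, hq' φ g hg, ← add_mul]
    simp only [eval_add]
  | monomial k a ih =>
    have := ih.mul hp h
    simpa [pow_succ, ← mul_assoc] using this

theorem isDiag_z_of_T {n : ℕ} (k : ℕ)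
    (h : ∀ i ≤ k, IsDiag hp (T F x n i) (fun g => walkContent x g i)) :
    IsDiag hp (∑ i ∈ Finset.range (k + 1), x ^ i • T F x n (k - i)) (fun g => walkZ x g k) := by
  have := IsDiag.sum hp (Finset.range (k + 1)) (fun i _ => (h (k - i) (by omega)).smul hp (x ^ i))
  intro φ g hg
  rw [this φ g hg]
  simp only [walkZ_eq_sum hg]

/-- Each term of the recursion is evaluated at a path. At a corner, the coefficient of the value at
the other path must cancel and that of the value at the path itself must be the content; both come
down to d'Ocagne's identity and the recursion of `p`. -/
theorem isDiag_T {n : ℕ} (k : ℕ) (hk : k ≤ n) :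
    IsDiag hp (T F x n k) (fun g => walkContent x g k) := by
  induction k using Nat.strong_induction_on with
  | _ k ih =>
  rcases k with _ | _ | _ | i
  · intro φ g hg; simp [T, walkContent]
  · intro φ g hg; simp [T, walkContent]
  · intro φ g hg
    have h0 := (hg 0).1
    have h1 := (hg 1).1
    have h2 : g 2 = g 1 ∨ g 2 = g 1 + 1 := (hg 1).2
    have g0 : g 0 = 0 := by omega
    have g1 : g 1 = 0 := by omega
    have hT : T F x n (0 + 1 + 1) = e F x n (0 + 1) := by simp [T]
    rw [hT, rep_e hp (by omega)]
    by_cases hc : g 2 = g 0 + 1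
    · have hu : Function.update g (0 + 1) (g 0) = g := by
        rw [Function.update_eq_iff]; exact ⟨by rw [g0, zero_add, g1], fun _ _ => rfl⟩
      rw [stepOp_corner hg hc, hu, g0]
      simp [walkContent, g1, hc, g0, p]
    · have : g 2 = 0 := by omega
      rw [stepOp_of_not_corner hc]
      simp [walkContent, g1, this, p]
  · have hT : ∀ φ g, IsWalk g → rep hp n (T F x n (i + 2)) φ g = walkContent x g (i + 2) * φ g :=
      ih (i + 2) (by omega) (by omega)
    have hz1 : ∀ φ g, IsWalk g → rep hp n (∑ k ∈ Finset.range (i + 1 + 1),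
        x ^ k • T F x n (i + 1 - k)) φ g = walkZ x g (i + 1) * φ g :=
      isDiag_z_of_T hp (n := n) (i + 1) fun j hj => ih j (by omega) (by omega)
    have hz0 : ∀ φ g, IsWalk g → rep hp n (∑ k ∈ Finset.range (i + 1),
        x ^ k • T F x n (i - k)) φ g = walkZ x g i * φ g :=
      isDiag_z_of_T hp (n := n) i fun j hj => ih j (by omega) (by omega)
    intro φ g hg
    rw [T]
    simp only [map_sub, map_add, map_neg, LinearMap.sub_apply, LinearMap.add_apply,
      LinearMap.neg_apply, Pi.sub_apply, Pi.add_apply, Pi.neg_apply, rep_mul_apply,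
      rep_e hp (show i + 1 + 1 < n by omega), rep_e hp (show i + 1 < n by omega)]
    beta_reduce
    rw [hz1 φ g hg, hT _ g hg, walkContent_succ hg (i + 1 + 1)]
    have b0 := (hg i).1
    have b1 := (hg (i + 1)).1
    have w0 := (hg i).2
    have w1 : g (i + 2) = g (i + 1) ∨ g (i + 2) = g (i + 1) + 1 := (hg (i + 1)).2
    have w2 : g (i + 3) = g (i + 2) ∨ g (i + 3) = g (i + 2) + 1 := (hg (i + 2)).2
    have b3 := (hg (i + 3)).1
    obtain ⟨s, hs⟩ : ∃ s, g (i + 1) = s := ⟨_, rfl⟩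
    obtain ⟨a, ha⟩ : ∃ a, i + 1 = 2 * s + a := ⟨i + 1 - 2 * s, by omega⟩
    by_cases hc : g (i + 3) = g (i + 1) + 1
    swap
    -- Without a corner only the term `z (i + 1)` remains, and the claim is the recursion of `p`
    -- along two equal steps.
    · simp only [stepOp_of_not_corner hc]
      rcases w1 with h | h
      · rw [walkZ_eq (k := i + 2 + 1) (v := s) (d := s + a + 2)
          (by change g (i + 3) = s; omega) (by omega),
          walkZ_eq (k := i + 2) (v := s) (d := s + a + 1) (by omega) (by omega),
          walkZ_eq (k := i + 1) (v := s) (d := s + a) (by omega) (by omega),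
          p_add_two x (s + a + 1)]
        ring
      · rw [walkZ_eq (k := i + 2 + 1) (v := s + 2) (d := s + a)
          (by change g (i + 3) = s + 2; omega) (by omega),
          walkZ_eq (k := i + 2) (v := s + 1) (d := s + a) (by omega) (by omega),
          walkZ_eq (k := i + 1) (v := s) (d := s + a) (by omega) (by omega), p_add_two x s]
        ring
    · -- the two possible contents at position `i + 2`
      set Rl : F := p F x s * p F x (s + a + 2) - x * (p F x s * p F x (s + a + 1)) with hRl
      set Rh : F := p F x (s + 1) * p F x (s + a + 1) - x * (p F x s * p F x (s + a + 1)) with hRh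
      have cont : ∀ g', IsWalk g' → g' (i + 1) = s →
          (g' (i + 2) = s → walkContent x g' (i + 2) = Rl) ∧
          (g' (i + 2) = s + 1 → walkContent x g' (i + 2) = Rh) := by
        intro g' hg' h
        rw [walkContent_succ hg', walkZ_eq (k := i + 1) (v := s) (d := s + a) h (by omega)]
        constructor
        · intro h'
          rw [walkZ_eq (k := i + 1 + 1) (v := s) (d := s + a + 1) h' (by omega)]
        · intro h'
          rw [walkZ_eq (k := i + 1 + 1) (v := s + 1) (d := s + a) h' (by omega)]
      have ul : ∀ b, Function.update g (i + 2) b (i + 1) = s := fun b => by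
        rw [Function.update_of_ne (by omega), hs]
      have us : ∀ b, Function.update g (i + 2) b (i + 2) = b := fun b => Function.update_self ..
      have hlow := hg.update_low hc
      have hS : ∀ ψ : (ℕ → ℕ) → F, stepOp x (i + 1) ψ g =
          (p F x (a + 2) * ψ (Function.update g (i + 2) s) +
            p F x a * ψ (Function.update g (i + 2) (s + 1))) / p F x (a + 1) := by
        intro ψ
        rw [stepOp_corner hg hc, hs, show i + 1 - 2 * s = a by omega]
      have t1 : stepOp x (i + 1) (rep hp n (T F x n (i + 2)) φ) g =
          (p F x (a + 2) * (Rl * φ (Function.update g (i + 2) s)) +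
            p F x a * (Rh * φ (Function.update g (i + 2) (s + 1)))) / p F x (a + 1) := by
        rw [stepOp_congr (ψ := fun g' => (if g' (i + 2) = s then Rl else Rh) * φ g') hg, hS]
        · simp only [us, if_true, Nat.succ_ne_self, if_false]
        · intro _
          rw [hT _ _ hlow, hs]
          change walkContent x (Function.update g (i + 2) s) (i + 2) * _ = _
          rw [(cont _ (hs ▸ hlow) (ul s)).1 (us s), us, if_pos rfl]
        · intro _ h'
          have hh := hg.update_high hc h'
          rw [hT _ _ hh, hs]
          change walkContent x (Function.update g (i + 2) (s + 1)) (i + 2) * _ = _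
          rw [(cont _ (hs ▸ hh) (ul (s + 1))).2 (us (s + 1)), us,
            if_neg (by omega)]
      -- The triple product sees the content on one path only, the one through `g i + 1` at `i + 2`.
      have t3 : stepOp x (i + 1)
          (stepOp x i (rep hp n (T F x n (i + 2)) (stepOp x (i + 1) φ))) g =
            (if g i = s then Rh else Rl) * stepOp x (i + 1) φ g := by
        have hw : IsWalk (Function.update g (i + 2) (g i + 1)) :=
          hg.update hc (by omega) (by omega)
        have hv : stepOp x (i + 1) (stepOp x i (rep hp n (T F x n (i + 2)) (stepOp x (i + 1) φ))) g
            = stepOp x (i + 1) (stepOp x i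
              (fun g' => walkContent x g' (i + 2) * stepOp x (i + 1) φ g')) g := by
          refine stepOp_congr hg ?_ ?_
          · intro _
            refine stepOp_congr hlow ?_ ?_
            · exact fun hc' => hT _ _ (hlow.update_low hc')
            · exact fun hc' h' => hT _ _ (hlow.update_high hc' h')
          · intro _ h''
            have hh := hg.update_high hc h''
            refine stepOp_congr hh ?_ ?_
            · exact fun hc' => hT _ _ (hh.update_low hc')
            · exact fun hc' h' => hT _ _ (hh.update_high hc' h')
        rw [hv, stepOp_succ_mul_stepOp hp hg hc]
        · rw [stepOp_update hg hc hw]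
          congr 1
          split_ifs with h
          · exact (cont _ hw (ul _)).2 (by rw [us, h])
          · exact (cont _ hw (ul _)).1 (by rw [us]; omega)
        · intro g' h'
          rw [stepOp_of_not_corner h', mul_zero]
      have t5 : stepOp x (i + 1)
          (rep hp n (∑ k ∈ Finset.range (i + 1), x ^ k • T F x n (i - k)) φ) g =
            walkZ x g i * stepOp x (i + 1) φ g := by
        have hi : ∀ b, walkZ x (Function.update g (i + 1 + 1) b) i = walkZ x g i := fun b => by
          rw [walkZ, walkZ, Function.update_of_ne (by omega)]
        rw [stepOp_congr (ψ := walkZ x g i • φ) hg, map_smul, Pi.smul_apply, smul_eq_mul]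
        · intro _; rw [hz0 _ _ hlow, hi, Pi.smul_apply, smul_eq_mul]
        · intro _ h'; rw [hz0 _ _ (hg.update_high hc h'), hi, Pi.smul_apply, smul_eq_mul]
      -- The combination of the third and last terms no longer depends on `g i`.
      have hsum : (if g i = s then Rh else Rl) - walkZ x g i = Rl + Rh := by
        split_ifs with h
        · obtain ⟨a, rfl⟩ : ∃ a', a = a' + 1 := ⟨a - 1, by omega⟩
          rw [walkZ_eq (k := i) (v := s) (d := s + a) h (by omega), hRl,
            show s + (a + 1) + 2 = s + a + 1 + 2 by omega, p_add_two x (s + a + 1),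
            show s + (a + 1) + 1 = s + a + 1 + 1 by omega]
          ring
        · obtain ⟨s, rfl⟩ : ∃ s', s = s' + 1 := ⟨s - 1, by omega⟩
          rw [walkZ_eq (k := i) (v := s) (d := s + 1 + a) (by omega) (by omega), hRh, p_add_two x s]
          ring
      have hdiff : Rh - Rl = p F x (a + 1) := by
        have := p_mul_sub_p_mul x s (a + 1)
        rw [show a + 1 + s = s + a + 1 by omega, show s + a + 1 + 1 = s + a + 2 by omega] at this
        rw [hRh, hRl]; linear_combination this
      have hz : walkZ x g (i + 1) = p F x s * p F x (s + a + 1) :=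
        walkZ_eq (v := s) (d := s + a) hs (by omega)
      have hp1 := hp a
      rw [t1, t3, t5, hS, hz,
        walkZ_eq (k := i + 2 + 1) (v := s + 1) (d := s + a + 1)
          (by change g (i + 3) = s + 1; omega) (by omega)]
      rcases w1 with h | h
      · have hu : Function.update g (i + 2) s = g := by
          rw [Function.update_eq_iff]; exact ⟨by omega, fun _ _ => rfl⟩
        have hR := (cont g hg hs).1 (by omega)
        rw [hu, hR, walkZ_eq (k := i + 2) (v := s) (d := s + a + 1) (by omega) (by omega)]
        have d := p_mul_sub_p_mul x s (a + 2)
        rw [show a + 2 + s = s + a + 2 by omega, p_add_two x (s + a + 1)] at d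
        simp only [show s + a + 1 + 1 = s + a + 2 by omega] at d ⊢
        field_simp
        linear_combination (p F x (a + 2) * φ g + p F x a * φ (Function.update g (i + 2) (s + 1)))
          * hsum + p F x (a + 2) * φ g * hdiff - p F x (a + 1) * φ g * d
      · have hu : Function.update g (i + 2) (s + 1) = g := by
          rw [Function.update_eq_iff]; exact ⟨by omega, fun _ _ => rfl⟩
        have hR := (cont g hg hs).2 (by omega)
        rw [hu, hR, walkZ_eq (k := i + 2) (v := s + 1) (d := s + a) (by omega) (by omega)]
        have d := p_mul_sub_p_mul x s a
        rw [show a + s = s + a by omega] at d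
        simp only [show s + a + 1 + 1 = s + a + 2 by omega] at d ⊢
        have d2 := p_add_two x (s + a)
        field_simp
        linear_combination (p F x (a + 2) * φ (Function.update g (i + 2) s) + p F x a * φ g)
          * hsum - p F x a * φ g * hdiff + p F x (a + 1) * φ g * d
          - p F x (a + 1) * φ g * p F x (s + 1) * d2

theorem isDiag_z {n : ℕ} (k : ℕ) (hk : k ≤ n) :
    IsDiag hp (z F x n k) (fun g => walkZ x g k) :=
  isDiag_z_of_T hp k fun i hi => isDiag_T hp i (hi.trans hk)

end Rep

/-! ### Triangularity of the Murphy basis in the path representation -/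

section Triangular

variable {F : Type*} [Field F] {x : F}

/-- The first components of the most dominant path of shape `(f, k - 2 f)`. -/
def topWalk (f : ℕ) : ℕ → ℕ := fun k => min (k / 2) f

theorem isWalk_topWalk (f : ℕ) : IsWalk (topWalk f) := by
  intro k
  simp only [topWalk]
  omega

variable (hp : ∀ i, p F x (i + 1) ≠ 0) {n : ℕ}
include hp

/-- Each odd generator forces a corner, so the first component must rise by one on every pair of
steps up to `2 * f`. -/
theorem rep_oddProd_eq_zero {f : ℕ} (hf : 2 * f ≤ n) {g : ℕ → ℕ} (hg : IsWalk g)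
    (h : g (2 * f) ≠ f) (φ : (ℕ → ℕ) → F) : rep hp n (oddProd F x n f) φ g = 0 := by
  induction f generalizing g with
  | zero => exact absurd (by have := (hg 0).1; rw [mul_zero]; omega) h
  | succ f ih =>
    rw [oddProd_succ, oddProd_comm_e le_rfl, rep_mul_apply, rep_e hp (by omega),
      stepOp_congr (ψ := 0) hg, map_zero, Pi.zero_apply]
    · intro hc
      refine ih (by omega) (hg.update_low hc) ?_
      rw [Function.update_of_ne (by omega)]
      rintro h'
      exact h (by rw [mul_add, mul_one, hc, h'])
    · intro hc hh
      refine ih (by omega) (hg.update_high hc hh) ?_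
      rw [Function.update_of_ne (by omega)]
      rintro h'
      exact h (by rw [mul_add, mul_one, hc, h'])

/-- Along the zigzag each odd generator meets the bottom case, with coefficients `p 2 / p 1 = x` and
`p 0 / p 1 = 0`. -/
theorem rep_oddProd_top {f : ℕ} (hf : 2 * f ≤ n) {g : ℕ → ℕ} (hg : IsWalk g)
    (h : ∀ i ≤ 2 * f, g i = i / 2) (φ : (ℕ → ℕ) → F) :
    rep hp n (oddProd F x n f) φ g = x ^ f * φ g := by
  induction f with
  | zero => simp [oddProd_zero]
  | succ f ih =>
    have h0 := h (2 * f) (by omega)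
    have h1 := h (2 * f + 1) (by omega)
    have h2 := h (2 * f + 2) (by omega)
    have hu : Function.update g (2 * f + 1) (g (2 * f)) = g := by
      rw [Function.update_eq_iff]; exact ⟨by omega, fun _ _ => rfl⟩
    rw [oddProd_succ, oddProd_comm_e le_rfl, rep_mul_apply, rep_e hp (by omega),
      stepOp_corner hg (by omega), hu, ih (by omega) fun i hi => h i (by omega),
      show 2 * f - 2 * g (2 * f) = 0 by omega]
    simp only [p]
    ring

/-- Each letter replaces a coordinate by its predecessor or by one more, so walks reached from `u`
stay above the most dominant path with first component `f - 1`. -/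
theorem rep_w_eq_zero {f k : ℕ} (hf : 1 ≤ f) (hk : 2 * f ≤ k + 1) (hn : k + 1 ≤ n) {u : ℕ → ℕ}
    (hu : IsWalk u) (h : ∀ i ≤ k + 1, min (i / 2) f ≤ u i) {ψ : (ℕ → ℕ) → F}
    (hψ : ∀ u', IsWalk u' → (∀ i ≤ k, min (i / 2) (f - 1) ≤ u' i) →
      (∀ i, k + 1 ≤ i → u' i = u i) → ψ u' = 0) :
    rep hp n (w F x n (2 * f) (k + 1)) ψ u = 0 := by
  obtain ⟨d, hd⟩ := Nat.exists_eq_add_of_le hk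
  induction d generalizing k ψ with
  | zero =>
    rw [hd, add_zero, w_self, map_one, Module.End.one_apply]
    exact hψ u hu (fun i hi => le_trans (by omega) (h i (by omega))) fun _ _ => rfl
  | succ d ih =>
    obtain ⟨k, rfl⟩ : ∃ k', k = k' + 1 := ⟨k - 1, by omega⟩
    rw [w_succ_right (by omega), rep_mul_apply, rep_e hp (by omega)]
    refine ih (by omega) (by omega) (fun i hi => h i (by omega)) ?_ (by omega)
    intro u' hu' h1 h2
    have key : ∀ b, u' k ≤ b → IsWalk (Function.update u' (k + 1) b) →
        ψ (Function.update u' (k + 1) b) = 0 := by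
      intro b hb hw
      refine hψ _ hw (fun i hi => ?_) fun i hi => ?_
      · by_cases hik : i = k + 1
        · subst hik
          rw [Function.update_self]
          have := h1 k le_rfl
          omega
        · rw [Function.update_of_ne hik]
          exact h1 i (by omega)
      · rw [Function.update_of_ne (by omega)]
        exact h2 i (by omega)
    rw [stepOp_congr (ψ := 0) hu', map_zero, Pi.zero_apply]
    · exact fun hc => key _ le_rfl (hu'.update_low hc)
    · exact fun hc hh => key _ (by omega) (hu'.update_high hc hh)

/-- Support half of triangularity: only walks dominating `s` are reached. The induction works
because `rep_w_eq_zero` returns the same lower bound for the truncated path. -/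
theorem rep_walkV_eq_zero {s : ℕ → ℕ} (hs : IsWalk s) {k : ℕ} (hn : k ≤ n) {u : ℕ → ℕ}
    (hu : IsWalk u) (h : ∀ i ≤ k, min (i / 2) (s k) ≤ u i) {φ : (ℕ → ℕ) → F}
    (hφ : ∀ u', IsWalk u' → (∀ i ≤ k, s i ≤ u' i) → (∀ i, k ≤ i → u' i = u i) → φ u' = 0) :
    rep hp n (walkV F x n s k) φ u = 0 := by
  induction k generalizing u φ with
  | zero =>
    rw [walkV, map_one, Module.End.one_apply]
    exact hφ u hu (fun i hi => by have := (hs i).1; omega) fun _ _ => rfl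
  | succ k ih =>
    have hs1 := (hs (k + 1)).1
    rw [walkV]
    split_ifs with hd
    · refine ih (by omega) hu (fun i hi => hd ▸ h i (by omega)) fun u' hu' h1 h2 => ?_
      refine hφ u' hu' (fun i hi => ?_) fun i hi => h2 i (by omega)
      rcases Nat.lt_or_ge k i with h' | h'
      · obtain rfl : i = k + 1 := by omega
        have := h (k + 1) le_rfl
        have := h2 (k + 1) (by omega)
        omega
      · exact h1 i h'
    · have hd' : s (k + 1) = s k + 1 := (hs k).2.resolve_left hd
      rw [rep_mul_apply]
      refine rep_w_eq_zero hp (by omega) hs1 hn hu h fun u' hu' h1 h2 => ?_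
      refine ih (by omega) hu' (fun i hi => ?_) fun u'' hu'' h3 h4 => ?_
      · have := h1 i hi
        omega
      · refine hφ u'' hu'' (fun i hi => ?_) fun i hi => ?_
        · rcases Nat.lt_or_ge k i with h' | h'
          · obtain rfl : i = k + 1 := by omega
            have := h (k + 1) le_rfl
            have := h4 (k + 1) (by omega)
            have := h2 (k + 1) le_rfl
            omega
          · exact h3 i h'
        · rw [h4 i (by omega), h2 i hi]

omit hp in
/-- Follow the most dominant path of first component `f` up to `k`, and `u` afterwards. -/
def topThen (f k : ℕ) (u : ℕ → ℕ) : ℕ → ℕ := fun i => if i ≤ k then min (i / 2) f else u i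

omit hp in
theorem isWalk_topThen {f k : ℕ} (hk : 2 * f + 2 ≤ k + 1) {u : ℕ → ℕ} (hu : IsWalk u)
    (h : u (k + 1) = f + 1) : IsWalk (topThen f k u) := by
  intro i
  have h1 := hu i
  simp only [topThen]
  rcases lt_trichotomy i k with hi | rfl | hi
  · rw [if_pos hi.le, if_pos (by omega)]; omega
  · rw [if_pos le_rfl, if_neg (by omega)]; omega
  · rw [if_neg (by omega), if_neg (by omega)]; exact h1

/-- The word delays the rise from `f` to `f + 1` until step `k + 1`. Taking the lower way at each
corner gives the leading term; the vanishing condition on `ψ` discards the only competing walk. -/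
theorem rep_w_leading {f k : ℕ} (hk : 2 * f + 2 ≤ k + 1) (hn : k + 1 ≤ n) {u : ℕ → ℕ}
    (hu : IsWalk u) (h : ∀ i ≤ k + 1, u i = min (i / 2) (f + 1)) :
    ∃ c : F, c ≠ 0 ∧ ∀ ψ : (ℕ → ℕ) → F,
      (IsWalk (Function.update (topThen f k u) k (f + 1)) →
        ψ (Function.update (topThen f k u) k (f + 1)) = 0) →
      rep hp n (w F x n (2 * (f + 1)) (k + 1)) ψ u = c * ψ (topThen f k u) := by
  obtain ⟨d, hd⟩ := Nat.exists_eq_add_of_le hk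
  induction d generalizing k with
  | zero =>
    refine ⟨1, one_ne_zero, fun ψ _ => ?_⟩
    have hu' : topThen f k u = u := by
      funext i
      simp only [topThen]
      split_ifs with hi
      · rw [h i (by omega)]; omega
      · rfl
    rw [hd, add_zero, show 2 * (f + 1) = 2 * f + 2 by omega, w_self, map_one, Module.End.one_apply,
      hu', one_mul]
  | succ d ih =>
    obtain ⟨k, rfl⟩ : ∃ k', k = k' + 1 := ⟨k - 1, by omega⟩
    obtain ⟨c, hc, ih⟩ := ih (k := k) (by omega) (by omega) (fun i hi => h i (by omega)) (by omega)
    have hw : IsWalk (topThen f k u) := isWalk_topThen (by omega) hu (by rw [h _ (by omega)]; omega)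
    have e0 : topThen f k u k = f := by simp only [topThen, if_pos le_rfl]; omega
    have e2 : topThen f k u (k + 2) = f + 1 := by
      simp only [topThen]
      rw [if_neg (by omega), h (k + 2) le_rfl]; omega
    have hcor : topThen f k u (k + 2) = topThen f k u k + 1 := by rw [e0, e2]
    have hlow : Function.update (topThen f k u) (k + 1) f = topThen f (k + 1) u := by
      funext i
      by_cases hi : i = k + 1
      · subst hi
        rw [Function.update_self]
        simp only [topThen, if_pos le_rfl]; omega
      · rw [Function.update_of_ne hi]
        simp only [topThen]
        by_cases hi' : i ≤ k
        · rw [if_pos hi', if_pos (by omega)]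
        · rw [if_neg hi', if_neg (by omega)]
    have hhigh : Function.update (topThen f k u) (k + 1) (f + 1) =
        Function.update (topThen f (k + 1) u) (k + 1) (f + 1) := by
      rw [← hlow, Function.update_idem]
    -- The new factor is the coefficient of the lower way round a corner at height `k - 2 * f`.
    refine ⟨c * (p F x (k - 2 * f + 2) / p F x (k - 2 * f + 1)),
      mul_ne_zero hc (div_ne_zero (hp _) (hp _)), fun ψ hψ => ?_⟩
    have hw2 := hw.update_high hcor (by rw [e0]; omega)
    rw [e0, hhigh] at hw2
    rw [w_succ_right (by omega), rep_mul_apply, rep_e hp (by omega), ih, stepOp_corner hw hcor, e0,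
      hlow, hhigh, hψ hw2]
    · ring
    · intro _
      apply stepOp_of_not_corner
      rw [Function.update_self, Function.update_of_ne (by omega), e2]
      omega

omit hp in
/-- Follow `s` up to `k`, and `u` afterwards. -/
def glue (s : ℕ → ℕ) (k : ℕ) (u : ℕ → ℕ) : ℕ → ℕ := fun i => if i ≤ k then s i else u i

/-- Diagonal half of triangularity: the leading terms of successive words compose to a nonzero
coefficient at the walk following `s`. -/
theorem rep_walkV_leading {s : ℕ → ℕ} (hs : IsWalk s) {k : ℕ} (hn : k ≤ n) {u : ℕ → ℕ}
    (hu : IsWalk u) (h : ∀ i ≤ k, u i = min (i / 2) (s k)) :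
    ∃ c : F, c ≠ 0 ∧ ∀ φ : (ℕ → ℕ) → F,
      (∀ u', IsWalk u' → (∀ i ≤ k, s i ≤ u' i) → (∀ i, k ≤ i → u' i = u i) →
        u' ≠ glue s k u → φ u' = 0) →
      rep hp n (walkV F x n s k) φ u = c * φ (glue s k u) := by
  induction k generalizing u with
  | zero =>
    refine ⟨1, one_ne_zero, fun φ _ => ?_⟩
    have : glue s 0 u = u := by
      funext i
      simp only [glue]
      split_ifs with hi
      · have := (hs i).1
        have := (hu i).1
        omega
      · rfl
    rw [this, walkV, map_one, Module.End.one_apply, one_mul]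
  | succ k ih =>
    have hs1 := (hs (k + 1)).1
    have huk : u (k + 1) = s (k + 1) := by rw [h _ le_rfl]; omega
    rw [walkV]
    split_ifs with hd
    · have hg : glue s k u = glue s (k + 1) u := by
        funext i
        simp only [glue]
        by_cases hi : i ≤ k
        · rw [if_pos hi, if_pos (by omega)]
        · rw [if_neg hi]
          split_ifs with hi'
          · obtain rfl : i = k + 1 := by omega
            exact huk
          · rfl
      obtain ⟨c, hc, ih⟩ := ih (by omega) hu (fun i hi => hd ▸ h i (by omega))
      refine ⟨c, hc, fun φ hφ => ?_⟩
      rw [← hg]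
      refine ih φ fun u' hu' h1 h2 h3 => hφ u' hu' (fun i hi => ?_) (fun i hi => h2 i (by omega))
        (hg ▸ h3)
      rcases Nat.lt_or_ge k i with h' | h'
      · obtain rfl : i = k + 1 := by omega
        rw [h2 _ (by omega), huk]
      · exact h1 i h'
    · have hd' : s (k + 1) = s k + 1 := (hs k).2.resolve_left hd
      have hP : IsWalk (topThen (s k) k u) := isWalk_topThen (by omega) hu (by omega)
      obtain ⟨c₁, hc₁, h₁⟩ := rep_w_leading hp (f := s k) (by omega) hn hu
        (fun i hi => by rw [h i hi, hd'])
      obtain ⟨c₂, hc₂, h₂⟩ := ih (by omega) hP (fun i hi => by simp [topThen, hi])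
      have hg : glue s k (topThen (s k) k u) = glue s (k + 1) u := by
        funext i
        simp only [glue, topThen]
        by_cases hi : i ≤ k
        · rw [if_pos hi, if_pos (by omega)]
        · rw [if_neg hi, if_neg hi]
          split_ifs with hi'
          · obtain rfl : i = k + 1 := by omega
            exact huk
          · rfl
      refine ⟨c₁ * c₂, mul_ne_zero hc₁ hc₂, fun φ hφ => ?_⟩
      have hext : ∀ (b : ℕ) (u' : ℕ → ℕ), (∀ i ≤ k, s i ≤ u' i) →
          (∀ i, k ≤ i → u' i = Function.update (topThen (s k) k u) k b i) →
          (∀ i ≤ k + 1, s i ≤ u' i) ∧ ∀ i, k + 1 ≤ i → u' i = u i := by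
        intro b u' h3 h4
        have h5 : ∀ i, k + 1 ≤ i → u' i = u i := fun i hi => by
          rw [h4 i (by omega), Function.update_of_ne (by omega)]
          simp only [topThen]
          rw [if_neg (by omega)]
        refine ⟨fun i hi => ?_, h5⟩
        rcases Nat.lt_or_ge k i with h' | h'
        · obtain rfl : i = k + 1 := by omega
          rw [h5 _ le_rfl, huk]
        · exact h3 i h'
      rw [hd', rep_mul_apply, h₁, h₂, hg, mul_assoc]
      · intro u' hu' h3 h4 h5
        rw [hg] at h5
        obtain ⟨h6, h7⟩ := hext (topThen (s k) k u k) u' h3 (by rwa [Function.update_eq_self])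
        exact hφ u' hu' h6 h7 h5
      -- The competing walk has value `s k + 1` at `k`. Every walk reached from it keeps that value,
      -- so it cannot be the glued walk, whose value there is `s k`.
      · intro hQ
        refine rep_walkV_eq_zero hp hs (by omega) hQ (fun i hi => ?_) fun u' hu' h3 h4 => ?_
        · by_cases hik : i = k
          · subst hik
            rw [Function.update_self]; omega
          · rw [Function.update_of_ne hik]
            simp [topThen, hi]
        · obtain ⟨h6, h7⟩ := hext _ u' h3 h4
          refine hφ u' hu' h6 h7 fun h8 => ?_
          have h9 := h4 k le_rfl
          rw [Function.update_self, h8] at h9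
          simp only [glue] at h9
          rw [if_pos (by omega)] at h9
          omega

end Triangular

/-! ### An invariant form on the path representation -/

section Form

variable {F : Type*} [Field F] {x : F}

variable (x) in
/-- The weight of a path in the invariant form. -/
def weight (n : ℕ) (g : ℕ → ℕ) : F := ∏ i ∈ Finset.range n, p F x (i - 2 * g i + 1)

variable (x) in
/-- The invariant form on functions on the finite set `W` of paths. -/
def walkForm (n : ℕ) (W : Finset (ℕ → ℕ)) (φ ψ : (ℕ → ℕ) → F) : F :=
  ∑ g ∈ W, weight x n g * φ g * ψ g

theorem walkForm_comm (n : ℕ) (W : Finset (ℕ → ℕ)) (φ ψ : (ℕ → ℕ) → F) :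
    walkForm x n W φ ψ = walkForm x n W ψ φ :=
  Finset.sum_congr rfl fun g _ => by ring

open Classical in
/-- Exchange the two paths that differ at `j + 1` only. -/
noncomputable def flipAt (j : ℕ) (g : ℕ → ℕ) : ℕ → ℕ :=
  if g (j + 2) = g j + 1 ∧ 2 * g j < j then Function.update g (j + 1) (2 * g j + 1 - g (j + 1))
  else g

theorem flipAt_of_ne {i j : ℕ} (h : i ≠ j + 1) (g : ℕ → ℕ) : flipAt j g i = g i := by
  unfold flipAt
  split_ifs
  · exact Function.update_of_ne h _ _
  · rfl

theorem IsWalk.flipAt {j : ℕ} {g : ℕ → ℕ} (hg : IsWalk g) : IsWalk (flipAt j g) := by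
  unfold TemperleyLieb.flipAt
  split_ifs with h
  · have := (hg j).2
    exact hg.update h.1 (by omega) (by omega)
  · exact hg

theorem flipAt_flipAt {j : ℕ} {g : ℕ → ℕ} (hg : IsWalk g) : flipAt j (flipAt j g) = g := by
  by_cases h : g (j + 2) = g j + 1 ∧ 2 * g j < j
  · have h' : flipAt j g (j + 2) = flipAt j g j + 1 ∧ 2 * flipAt j g j < j := by
      rwa [flipAt_of_ne (by omega), flipAt_of_ne (by omega)]
    have h1 : flipAt j g = Function.update g (j + 1) (2 * g j + 1 - g (j + 1)) := if_pos h
    have h2 : flipAt j (flipAt j g) = _ := if_pos h'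
    have := (hg j).2
    rw [h2, h1, Function.update_idem, Function.update_self, Function.update_of_ne (by omega),
      Function.update_eq_iff]
    exact ⟨by omega, fun _ _ => rfl⟩
  · have h1 : flipAt j g = g := if_neg h
    rw [h1, h1]

variable (hp : ∀ i, p F x (i + 1) ≠ 0)

theorem weight_ne_zero (n : ℕ) (g : ℕ → ℕ) (hp : ∀ i, p F x (i + 1) ≠ 0) : weight x n g ≠ 0 :=
  Finset.prod_ne_zero_iff.2 fun _ _ => hp _

/-- Symmetry of the weighted operator: its matrix has a diagonal part and a part exchanging the two
paths of a corner, with equal coefficients since both ways give `D * p (a + 2) * p a / p (a + 1)`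
for `a = j - 2 * g j`. -/
theorem weight_mul_stepOp {n j : ℕ} (hj : j + 1 < n) :
    ∃ s c : (ℕ → ℕ) → F, (∀ g, c (flipAt j g) = c g) ∧ ∀ φ g, IsWalk g →
      weight x n g * stepOp x j φ g = s g * φ g + c g * φ (flipAt j g) := by
  classical
  set D : (ℕ → ℕ) → F := fun g =>
    ∏ i ∈ (Finset.range n).erase (j + 1), p F x (i - 2 * g i + 1) with hD
  have hw : ∀ g, weight x n g = p F x (j + 1 - 2 * g (j + 1) + 1) * D g := fun g =>
    (Finset.mul_prod_erase _ _ (Finset.mem_range.2 hj)).symm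
  refine ⟨fun g => if g (j + 2) = g j + 1 then
      weight x n g * p F x (j + 1 - 2 * g (j + 1) + 1) / p F x (j - 2 * g j + 1) else 0,
    fun g => if g (j + 2) = g j + 1 ∧ 2 * g j < j then
      D g * p F x (j - 2 * g j + 2) * p F x (j - 2 * g j) / p F x (j - 2 * g j + 1) else 0,
    fun g => ?_, fun φ g hg => ?_⟩
  · have hDf : D (flipAt j g) = D g :=
      Finset.prod_congr rfl fun i hi => by rw [flipAt_of_ne (Finset.ne_of_mem_erase hi)]
    simp only [hDf, flipAt_of_ne (show j + 2 ≠ j + 1 by omega), flipAt_of_ne (show j ≠ j + 1 by omega)]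
  · by_cases hc : g (j + 2) = g j + 1
    swap
    · simp [stepOp_of_not_corner hc, hc]
    have hb := (hg j).1
    have hb1 := (hg (j + 1)).1
    rw [stepOp_corner hg hc]
    simp only [hc, true_and, if_true]
    rcases (hg j).2 with h | h
    · have hu : Function.update g (j + 1) (g j) = g := by
        rw [Function.update_eq_iff]; exact ⟨h.symm, fun _ _ => rfl⟩
      rw [hu, hw, h, show j + 1 - 2 * g j + 1 = j - 2 * g j + 2 by omega]
      by_cases ha : 2 * g j < j
      · have hf : flipAt j g = Function.update g (j + 1) (g j + 1) := by
          rw [flipAt, if_pos ⟨hc, ha⟩, h]; congr 1; omega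
        rw [if_pos ha, hf]
        ring
      · rw [if_neg ha, show j - 2 * g j = 0 by omega]
        simp only [p]
        ring
    · have hu : Function.update g (j + 1) (g j + 1) = g := by
        rw [Function.update_eq_iff]; exact ⟨h.symm, fun _ _ => rfl⟩
      have ha : 2 * g j < j := by omega
      have hf : flipAt j g = Function.update g (j + 1) (g j) := by
        rw [flipAt, if_pos ⟨hc, ha⟩, h]; congr 1; omega
      rw [hu, hw, h, show j + 1 - 2 * (g j + 1) + 1 = j - 2 * g j by omega, if_pos ha, hf]
      ring

/-- The operators of `y` and `y'` are adjoint with respect to the invariant form. -/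
def IsAdj (n : ℕ) (W : Finset (ℕ → ℕ)) (y y' : TL F x n) : Prop :=
  ∀ φ ψ, walkForm x n W (rep hp n y φ) ψ = walkForm x n W φ (rep hp n y' ψ)

variable {n f : ℕ} {W : Finset (ℕ → ℕ)}

theorem isAdj_one : IsAdj hp n W 1 1 := fun φ ψ => by simp

theorem IsAdj.mul {a a' b b' : TL F x n} (ha : IsAdj hp n W a a') (hb : IsAdj hp n W b b') :
    IsAdj hp n W (a * b) (b' * a') := fun φ ψ => by
  rw [map_mul, map_mul, Module.End.mul_apply, Module.End.mul_apply, ha, hb]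

variable (hW : ∀ g, g ∈ W ↔ IsWalk g ∧ ∀ i, n ≤ i → g i = f)
include hW

theorem isAdj_e (i : ℕ) : IsAdj hp n W (e F x n i) (e F x n i) := by
  intro φ ψ
  by_cases hi : 1 ≤ i ∧ i < n
  swap
  · rw [e_of_not hi]; simp [walkForm]
  obtain ⟨j, rfl⟩ : ∃ j, i = j + 1 := ⟨i - 1, by omega⟩
  rw [rep_e hp hi.2]
  obtain ⟨s, c, hc, h⟩ := weight_mul_stepOp (x := x) hi.2
  have hflip : ∀ g ∈ W, flipAt j g ∈ W := by
    intro g hg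
    rw [hW] at hg ⊢
    exact ⟨hg.1.flipAt, fun i hi' => by rw [flipAt_of_ne (by omega), hg.2 i hi']⟩
  have hsum : ∀ φ ψ : (ℕ → ℕ) → F, walkForm x n W (stepOp x j φ) ψ =
      ∑ g ∈ W, s g * φ g * ψ g + ∑ g ∈ W, c g * φ (flipAt j g) * ψ g := by
    intro φ ψ
    rw [walkForm, ← Finset.sum_add_distrib]
    refine Finset.sum_congr rfl fun g hg => ?_
    rw [h φ g ((hW g).1 hg).1]
    ring
  rw [walkForm_comm n W φ, hsum, hsum]
  congr 1
  · exact Finset.sum_congr rfl fun g _ => by ring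
  · refine Finset.sum_nbij' (flipAt j) (flipAt j) hflip hflip
      (fun g hg => flipAt_flipAt ((hW g).1 hg).1) (fun g hg => flipAt_flipAt ((hW g).1 hg).1) ?_
    intro g hg
    rw [hc, flipAt_flipAt ((hW g).1 hg).1]
    ring

theorem isAdj_oddProd (k : ℕ) : IsAdj hp n W (oddProd F x n k) (oddProd F x n k) := by
  induction k with
  | zero => rw [oddProd_zero]; exact isAdj_one hp
  | succ k ih =>
    have := ih.mul hp (isAdj_e hp hW (2 * k + 1))
    rwa [← oddProd_comm_e le_rfl, ← oddProd_succ] at this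

theorem isAdj_list_prod (L : List ℕ) :
    IsAdj hp n W (L.map (e F x n)).prod (L.reverse.map (e F x n)).prod := by
  induction L with
  | nil => simpa using isAdj_one hp
  | cons i L ih => simpa using (isAdj_e hp hW i).mul hp ih

theorem isAdj_w {a b : ℕ} (h : a ≤ b) : IsAdj hp n W (w F x n a b) (w F x n b a) := by
  rcases h.lt_or_eq with h | rfl
  · rw [w, if_pos h, w, if_neg (by omega), if_pos h]
    exact isAdj_list_prod hp hW _
  · rw [w_self]; exact isAdj_one hp

theorem isAdj_walkV {s : ℕ → ℕ} (hs : IsWalk s) (k : ℕ) :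
    IsAdj hp n W (walkV F x n s k) (walkVStar F x n s k) := by
  induction k with
  | zero => exact isAdj_one hp
  | succ k ih =>
    rw [walkV, walkVStar]
    split_ifs with h
    · exact ih
    · exact (isAdj_w hp hW (hs (k + 1)).1).mul hp ih

end Form

/-! ### Finite paths as infinite walks -/

section Paths

variable {n : ℕ} {l : Part n}

theorem Path.idx_of_le (t : Path l) {k : ℕ} (h : k ≤ n) :
    t.idx k = (t.1 ⟨k, Nat.lt_succ_of_le h⟩).fst := dif_pos _

theorem Path.idx_last (t : Path l) : t.idx n = l.fst := by
  rw [t.idx_of_le le_rfl]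
  exact congrArg Part.fst t.2.2

/-- The first components of a path, continued by the last one. -/
def Path.walk (t : Path l) : ℕ → ℕ := fun k => t.idx (min k n)

theorem Path.walk_of_le (t : Path l) {k : ℕ} (h : k ≤ n) : t.walk k = t.idx k := by
  rw [Path.walk, min_eq_left h]

theorem Path.walk_of_ge (t : Path l) {k : ℕ} (h : n ≤ k) : t.walk k = l.fst := by
  rw [Path.walk, min_eq_right h, t.idx_last]

theorem Path.isWalk_walk (t : Path l) : IsWalk t.walk := by
  intro k
  constructor
  · have := (t.1 ⟨min k n, by omega⟩).sum_eq
    rw [Path.walk, t.idx_of_le (by omega)]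
    simp only at this
    omega
  · rcases Nat.lt_or_ge k n with h | h
    · rw [t.walk_of_le h.le, t.walk_of_le h, t.idx_of_le h.le, t.idx_of_le h]
      rcases t.2.1 ⟨k, h⟩ with h' | h'
      · exact Or.inl h'.1
      · exact Or.inr h'.1
    · rw [t.walk_of_ge h, t.walk_of_ge (by omega)]
      exact Or.inl rfl

theorem Path.walk_injective : Function.Injective (Path.walk : Path l → ℕ → ℕ) := by
  intro s t h
  apply Subtype.ext
  funext k
  have hk := congrFun h k.1
  rw [s.walk_of_le (by omega), t.walk_of_le (by omega), s.idx_of_le (by omega),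
    t.idx_of_le (by omega)] at hk
  have h1 := (s.1 k).sum_eq
  have h2 := (t.1 k).sum_eq
  have h3 : (s.1 k).fst = (t.1 k).fst := hk
  exact Part.ext h3 (by omega)

/-- The path with first components `g`. -/
def Path.ofWalk {g : ℕ → ℕ} (hg : IsWalk g) (h : g n = l.fst) : Path l :=
  ⟨fun k => ⟨g k, k - 2 * g k, by have := (hg k).1; omega⟩, fun k => by
    have h0 := (hg k).1
    have h1 := (hg (k + 1)).1
    rcases (hg k).2 with h | h
    · exact Or.inl ⟨h, by simp only [Fin.val_succ, Fin.val_castSucc]; omega⟩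
    · exact Or.inr ⟨h, by simp only [Fin.val_succ, Fin.val_castSucc]; omega⟩, by
    have h1 := l.sum_eq
    exact Part.ext h (by simp only [Fin.val_last]; omega)⟩

theorem Path.ofWalk_idx {g : ℕ → ℕ} (hg : IsWalk g) (h : g n = l.fst) {k : ℕ} (hk : k ≤ n) :
    (Path.ofWalk hg h).idx k = g k := Path.idx_of_le _ hk

theorem Path.ofWalk_walk {g : ℕ → ℕ} (hg : IsWalk g) (h : ∀ i, n ≤ i → g i = l.fst) :
    (Path.ofWalk hg (h n le_rfl)).walk = g := by
  funext k
  rcases Nat.le_total k n with hk | hk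
  · rw [Path.walk_of_le _ hk, Path.ofWalk_idx _ _ hk]
  · rw [Path.walk_of_ge _ hk, h k hk]

theorem Path.dom_iff {s t : Path l} : s.Dom t ↔ ∀ i ≤ n, t.walk i ≤ s.walk i := by
  constructor
  · intro h i hi
    rw [s.walk_of_le hi, t.walk_of_le hi, s.idx_of_le hi, t.idx_of_le hi]
    exact h ⟨i, by omega⟩
  · intro h k
    have := h k (by omega)
    rwa [s.walk_of_le (by omega), t.walk_of_le (by omega), s.idx_of_le (by omega),
      t.idx_of_le (by omega)] at this

theorem Path.Dom.trans {s t u : Path l} (h : s.Dom t) (h' : t.Dom u) : s.Dom u :=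
  fun k => le_trans (h' k) (h k)

/-- A height function that is strictly monotone for the dominance order. -/
def Path.rank (t : Path l) : ℕ := ∑ k : Fin (n + 1), t.walk k

theorem Path.Dom.eq_or_rank_lt {s t : Path l} (h : s.Dom t) : s = t ∨ t.rank < s.rank := by
  rw [Path.dom_iff] at h
  rw [or_iff_not_imp_left]
  intro hne
  obtain ⟨k, hk⟩ : ∃ k, s.walk k ≠ t.walk k := by
    by_contra! h'
    exact hne (Path.walk_injective (funext h'))
  have hkn : k ≤ n := by
    by_contra! h'
    exact hk (by rw [s.walk_of_ge h'.le, t.walk_of_ge h'.le])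
  refine Finset.sum_lt_sum (fun i _ => h i (by omega)) ⟨⟨k, by omega⟩, Finset.mem_univ _, ?_⟩
  exact lt_of_le_of_ne (h k hkn) (Ne.symm hk)

theorem two_mul_fst_le (l : Part n) : 2 * l.fst ≤ n := by have := l.sum_eq; omega

theorem topWalk_of_ge (l : Part n) {i : ℕ} (h : n ≤ i) : topWalk l.fst i = l.fst := by
  have := two_mul_fst_le l
  simp only [topWalk]
  omega

variable (l) in
/-- The most dominant path of shape `l`. -/
def topPath : Path l := Path.ofWalk (isWalk_topWalk l.fst) (topWalk_of_ge l le_rfl)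

theorem topPath_walk : (topPath l).walk = topWalk l.fst :=
  Path.ofWalk_walk _ fun _ => topWalk_of_ge l

variable {F : Type*} [Field F] {x : F}

theorem vTrunc_eq (t : Path l) {k : ℕ} (hk : k ≤ n) :
    vTrunc F x t k = walkV F x n t.walk k := by
  induction k with
  | zero => rfl
  | succ k ih => rw [vTrunc, walkV, ih (by omega), t.walk_of_le hk, t.walk_of_le (by omega)]

theorem vStarTrunc_eq (t : Path l) {k : ℕ} (hk : k ≤ n) :
    vStarTrunc F x t k = walkVStar F x n t.walk k := by
  induction k with
  | zero => rfl
  | succ k ih =>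
    rw [vStarTrunc, walkVStar, ih (by omega), t.walk_of_le hk, t.walk_of_le (by omega)]

theorem v_eq (t : Path l) : v F x t = walkV F x n t.walk n := vTrunc_eq t le_rfl

theorem vStar_eq (t : Path l) : vStar F x t = walkVStar F x n t.walk n := vStarTrunc_eq t le_rfl

theorem mPart_eq : mPart F x l = oddProd F x n l.fst := rfl

theorem two_mul_topWalk_succ {c k : ℕ} (h : topWalk c (k + 1) ≠ topWalk c k) :
    2 * topWalk c (k + 1) = k + 1 := by
  simp only [topWalk] at h ⊢
  omega

/-- Every rise of the most dominant path occurs as early as possible, so each word `w` is empty. -/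
theorem walkV_topWalk (c k : ℕ) : walkV F x n (topWalk c) k = 1 := by
  induction k with
  | zero => rfl
  | succ k ih =>
    rw [walkV, ih]
    split_ifs with h
    · rfl
    · rw [two_mul_topWalk_succ h, w_self, mul_one]

theorem walkVStar_topWalk (c k : ℕ) : walkVStar F x n (topWalk c) k = 1 := by
  induction k with
  | zero => rfl
  | succ k ih =>
    rw [walkVStar, ih]
    split_ifs with h
    · rfl
    · rw [two_mul_topWalk_succ h, w_self, mul_one]

theorem v_topPath : v F x (topPath l) = 1 := by rw [v_eq, topPath_walk, walkV_topWalk]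

theorem vStar_topPath : vStar F x (topPath l) = 1 := by
  rw [vStar_eq, topPath_walk, walkVStar_topWalk]

theorem r_eq (t : Path l) {k : ℕ} (hk : k ≤ n) : r F x t k = walkContent x t.walk k := by
  rw [walkContent, t.walk_of_le hk, t.walk_of_le (by omega)]
  rfl

theorem zContent_eq (t : Path l) {k : ℕ} (hk : k ≤ n) : zContent F x t k = walkZ x t.walk k := by
  rw [← walkZ_eq_sum t.isWalk_walk]
  exact Finset.sum_congr rfl fun i _ => by rw [r_eq t (by omega)]

theorem walkContent_mem_contents {g : ℕ → ℕ} (hg : IsWalk g) (k : ℕ) :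
    walkContent x g k ∈ contents F x k := by
  classical
  have hl : 2 * g k + (k - 2 * g k) = k := by have := (hg k).1; omega
  refine Finset.mem_image.2 ⟨⟨⟨g k, k - 2 * g k, hl⟩, Path.ofWalk hg rfl⟩, Finset.mem_univ _, ?_⟩
  rw [r_eq _ le_rfl, walkContent, walkContent, Path.walk_of_le _ le_rfl,
    Path.walk_of_le _ (by omega), Path.ofWalk_idx _ _ le_rfl, Path.ofWalk_idx _ _ (by omega)]

/-- By d'Ocagne's identity the two contents differ by `p (a + 1)` up to sign, where `a = k - 2 * g
k`. -/
theorem walkContent_ne (hp : ∀ i, p F x (i + 1) ≠ 0) {g g' : ℕ → ℕ} (hg : IsWalk g)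
    (hg' : IsWalk g') {k : ℕ} (h : g k = g' k) (h' : g (k + 1) ≠ g' (k + 1)) :
    walkContent x g (k + 1) ≠ walkContent x g' (k + 1) := by
  wlog hlt : g (k + 1) < g' (k + 1) generalizing g g'
  · exact (this hg' hg h.symm h'.symm (by omega)).symm
  have h1 := (hg k).2
  have h2 := (hg' k).2
  have h3 := (hg k).1
  obtain ⟨s, hs⟩ : ∃ s, g k = s := ⟨_, rfl⟩
  obtain ⟨a, ha⟩ : ∃ a, k = 2 * s + a := ⟨k - 2 * s, by omega⟩
  rw [walkContent_succ hg, walkContent_succ hg',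
    walkZ_eq (g := g) (k := k + 1) (v := s) (d := s + a + 1) (by omega) (by omega),
    walkZ_eq (g := g') (k := k + 1) (v := s + 1) (d := s + a) (by omega) (by omega),
    walkZ_eq (g := g) (k := k) (v := s) (d := s + a) (by omega) (by omega),
    walkZ_eq (g := g') (k := k) (v := s) (d := s + a) (by omega) (by omega)]
  have hd := p_mul_sub_p_mul x s (a + 1)
  rw [show a + 1 + s = s + a + 1 by omega] at hd
  intro heq
  exact hp a (by linear_combination -heq - hd)

end Paths

/-! ### A triangularity lemma -/

/-- Back substitution in order of rank. Allowing an upward closed set `U` of exceptions serves both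
independence (`U` empty) and the support of `f t` (`U` the paths dominating `t`). -/
theorem eq_zero_of_triangular {F ι : Type*} [Field F] [Fintype ι] (M : ι → ι → F)
    (R : ι → ι → Prop) (rk : ι → ℕ) (hd : ∀ t, M t t ≠ 0) (hM : ∀ t u, M t u ≠ 0 → R u t)
    (hR : ∀ u t, R u t → u = t ∨ rk t < rk u) (U : ι → Prop)
    (hU : ∀ u t, R u t → U t → U u) (a : ι → F)
    (h : ∀ w, ¬ U w → ∑ u, a u * M u w = 0) (u : ι) (hu : ¬ U u) : a u = 0 := by
  induction hk : rk u using Nat.strong_induction_on generalizing u with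
  | _ k ih =>
    subst hk
    have h1 := h u hu
    rw [Finset.sum_eq_single u] at h1
    · exact (mul_eq_zero.1 h1).resolve_right (hd u)
    · intro t _ htu
      by_cases hMt : M t u = 0
      · rw [hMt, mul_zero]
      · have hut := hM t u hMt
        rw [ih (rk t) ((hR u t hut).resolve_left htu.symm) t (fun ht => hu (hU u t hut ht)) rfl,
          zero_mul]
    · exact fun h' => absurd (Finset.mem_univ u) h'

/-! ### Coordinates on the cell modules -/

section Cell

variable {F : Type*} [Field F] {x : F} {n : ℕ} {l : Part n}

theorem mul_mem_idealAbove {a y b : TL F x n} (h : y ∈ idealAbove F x l) :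
    a * y * b ∈ idealAbove F x l :=
  (idealAbove F x l).mul_mem_right _ _ ((idealAbove F x l).mul_mem_left _ _ h)

theorem smul_mem_idealAbove (c : F) {y : TL F x n} (h : y ∈ idealAbove F x l) :
    c • y ∈ idealAbove F x l := by
  rw [Algebra.smul_def]
  exact (idealAbove F x l).mul_mem_left _ _ h

theorem aboveSpan_le_idealAbove {y : TL F x n} (hy : y ∈ aboveSpan F x n n l.fst) :
    y ∈ idealAbove F x l := by
  induction hy using Submodule.span_induction with
  | mem y hy =>
    obtain ⟨h, a, -, b, -, rfl⟩ := hy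
    apply mul_mem_idealAbove
    -- The next more dominant shape alone already produces all of `aboveSpan`.
    let l' : Part n := ⟨l.fst + 1, n - 2 * (l.fst + 1), by omega⟩
    have hl' : l'.SDom l := ⟨Nat.le_succ _, fun h' => absurd (congrArg Part.fst h') (by simp [l'])⟩
    have h1 : idealOf F x l' ≤ idealAbove F x l :=
      le_iSup₂ (f := fun (m : Part n) (_ : m.SDom l) => idealOf F x m) l' hl'
    exact h1 (TwoSidedIdeal.subset_span rfl)
  | zero => exact (idealAbove F x l).zero_mem
  | add a b _ _ ha hb => exact (idealAbove F x l).add_mem ha hb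
  | smul c a _ ha => exact smul_mem_idealAbove c ha

variable (hp : ∀ i, p F x (i + 1) ≠ 0)

/-- By locality, vanishing at all walks ending in `l` defines a two-sided ideal. It contains each
`mPart μ` with `μ ▷ l`: nonvanishing would force the walk to reach `μ.fst` at `2 * μ.fst`, and
monotonicity forbids this. -/
theorem rep_idealAbove {y : TL F x n} (hy : y ∈ idealAbove F x l) {g : ℕ → ℕ} (hg : IsWalk g)
    (hl : g n = l.fst) (φ : (ℕ → ℕ) → F) : rep hp n y φ g = 0 := by
  let I : TwoSidedIdeal (TL F x n) := TwoSidedIdeal.mk'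
    {y | ∀ g, IsWalk g → g n = l.fst → ∀ φ, rep hp n y φ g = 0}
    (fun g _ _ φ => by simp)
    (fun ha hb g hg hl φ => by
      rw [map_add, LinearMap.add_apply, Pi.add_apply, ha g hg hl, hb g hg hl, add_zero])
    (fun ha g hg hl φ => by rw [map_neg, LinearMap.neg_apply, Pi.neg_apply, ha g hg hl, neg_zero])
    (fun {a b} hb g hg hl φ => by
      rw [rep_mul_apply]
      exact rep_eq_zero hp a hg fun g' hg' h => hb g' hg' ((h n le_rfl).trans hl) φ)
    (fun {a b} ha g hg hl φ => by
      rw [rep_mul_apply]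
      exact ha g hg hl _)
  have hI : idealAbove F x l ≤ I := by
    refine iSup₂_le fun μ hμ => TwoSidedIdeal.span_le.2 ?_
    rintro _ rfl
    rw [SetLike.mem_coe, TwoSidedIdeal.mem_mk']
    intro g hg hl φ
    have h1 := two_mul_fst_le μ
    refine rep_oddProd_eq_zero hp h1 hg (fun h => ?_) φ
    have h2 := hg.mono h1
    rw [h, hl] at h2
    have h3 : l.fst = μ.fst := le_antisymm hμ.1 h2
    have h4 := l.sum_eq
    have h5 := μ.sum_eq
    exact hμ.2 (Part.ext h3.symm (by omega))
  have h := hI hy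
  rw [TwoSidedIdeal.mem_mk'] at h
  exact h g hg hl φ

/-! ### Coordinate functionals and triangularity. -/

open Classical in
/-- The indicator function of a path. -/
noncomputable def indic (g : ℕ → ℕ) : (ℕ → ℕ) → F := fun g' => if g' = g then 1 else 0

theorem indic_self (g : ℕ → ℕ) : (indic g g : F) = 1 := if_pos rfl

theorem indic_of_ne {g g' : ℕ → ℕ} (h : g' ≠ g) : (indic g g' : F) = 0 := if_neg h

variable (l) in
/-- The coordinates of an element of the algebra, applied to the most dominant path. -/
noncomputable def coordTL : TL F x n →ₗ[F] (Path l → F) where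
  toFun y u := rep hp n y (indic u.walk) (topWalk l.fst)
  map_add' a b := by funext u; simp
  map_smul' c a := by funext u; simp

variable (l) in
/-- The coordinates of an element of the cell module in the path representation. -/
noncomputable def coord : cell F x l →ₗ[F] (Path l → F) :=
  ((rightAbove F x l).restrictScalars F).liftQ (coordTL l hp) (by
    intro y hy
    funext u
    exact rep_idealAbove hp hy (isWalk_topWalk _) (topWalk_of_ge l le_rfl) _) ∘ₗ
  (Submodule.Quotient.restrictScalarsEquiv F (rightAbove F x l)).symm.toLinearMap ∘ₗ
  (cell F x l).subtype.restrictScalars F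

theorem coord_apply {c : cell F x l} {y : TL F x n} (h : c.1 = (rightAbove F x l).mkQ y)
    (u : Path l) : coord l hp c u = rep hp n y (indic u.walk) (topWalk l.fst) := by
  have : coord l hp c = coordTL l hp y := by
    simp only [coord, LinearMap.comp_apply, LinearMap.restrictScalars_apply, Submodule.subtype_apply,
      h]
    rfl
  rw [this]
  rfl

theorem exists_rep_cell (c : cell F x l) :
    ∃ y, c.1 = (rightAbove F x l).mkQ (mPart F x l * y) := by
  obtain ⟨y, hy⟩ := Submodule.mem_span_singleton.1 c.2
  exact ⟨y.unop, hy.symm⟩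

theorem op_smul_cell {c : cell F x l} {y : TL F x n} (h : c.1 = (rightAbove F x l).mkQ y)
    (a : TL F x n) : (MulOpposite.op a • c).1 = (rightAbove F x l).mkQ (y * a) := by
  rw [Submodule.coe_smul, h, ← map_smul]
  rfl

theorem m_val (t : Path l) : (m F x t).1 =
    (rightAbove F x l).mkQ (oddProd F x n l.fst * walkV F x n t.walk n) := by
  rw [← v_eq]
  exact op_smul_cell (c := cellGen F x l) rfl _

/-- The factor on the right acts first on the indicator of `u`, which is an eigenfunction on walks;
values off walks never reach the evaluation point. -/
theorem coord_isDiag {y : TL F x n} {c : (ℕ → ℕ) → F} (h : IsDiag hp y c) (a : cell F x l)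
    (u : Path l) : coord l hp (MulOpposite.op y • a) u = c u.walk * coord l hp a u := by
  obtain ⟨b, hb⟩ := exists_rep_cell a
  rw [coord_apply hp (op_smul_cell hb y), coord_apply hp hb, rep_mul_apply, ← sub_eq_zero,
    ← smul_eq_mul (c u.walk), ← Pi.smul_apply, ← map_smul, ← Pi.sub_apply, ← map_sub]
  refine rep_eq_zero hp _ (isWalk_topWalk _) fun g hg _ => ?_
  rw [Pi.sub_apply, h _ g hg, Pi.smul_apply, smul_eq_mul]
  by_cases hgu : g = u.walk
  · rw [hgu, sub_self]
  · rw [indic_of_ne hgu, mul_zero, mul_zero, sub_zero]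

theorem coord_m (t u : Path l) : coord l hp (m F x t) u =
    x ^ l.fst * rep hp n (walkV F x n t.walk n) (indic u.walk) (topWalk l.fst) := by
  rw [coord_apply hp (m_val t), rep_mul_apply, rep_oddProd_top hp (two_mul_fst_le l)
    (isWalk_topWalk _)]
  intro i hi
  simp only [topWalk]
  omega

theorem ne_zero_of_p (hp : ∀ i, p F x (i + 1) ≠ 0) : x ≠ 0 := by
  have := hp 1
  simpa [p] using this

theorem coord_m_self (t : Path l) : coord l hp (m F x t) t ≠ 0 := by
  rw [coord_m]
  refine mul_ne_zero (pow_ne_zero _ (ne_zero_of_p hp)) ?_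
  obtain ⟨c, hc, h⟩ := rep_walkV_leading hp t.isWalk_walk le_rfl (isWalk_topWalk l.fst)
    (fun i _ => by rw [t.walk_of_ge le_rfl]; rfl)
  have hg : glue t.walk n (topWalk l.fst) = t.walk := by
    funext i
    simp only [glue]
    split_ifs with hi
    · rfl
    · rw [topWalk_of_ge l (by omega), t.walk_of_ge (by omega)]
  rw [h, hg, indic_self, mul_one]
  · exact hc
  · intro u' _ _ _ hne
    exact indic_of_ne (hg ▸ hne)

theorem dom_of_coord_m_ne_zero (t u : Path l) (h : coord l hp (m F x t) u ≠ 0) : u.Dom t := by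
  by_contra hd
  apply h
  rw [coord_m, rep_walkV_eq_zero hp t.isWalk_walk le_rfl (isWalk_topWalk l.fst), mul_zero]
  · exact fun i _ => by rw [t.walk_of_ge le_rfl]; rfl
  · intro u' _ h1 _
    refine indic_of_ne fun h2 => hd (Path.dom_iff.2 ?_)
    rwa [← h2]

theorem sum_coord (a : Path l → F) (w : Path l) :
    coord l hp (∑ u, a u • m F x u) w = ∑ u, a u * coord l hp (m F x u) w := by
  rw [map_sum, Finset.sum_apply]
  exact Finset.sum_congr rfl fun u _ => by rw [map_smul, Pi.smul_apply, smul_eq_mul]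

theorem coeff_eq_zero (U : Path l → Prop) (hU : ∀ u t : Path l, u.Dom t → U t → U u)
    (a : Path l → F) (h : ∀ w, ¬ U w → coord l hp (∑ u, a u • m F x u) w = 0) (u : Path l)
    (hu : ¬ U u) : a u = 0 :=
  eq_zero_of_triangular (fun t u => coord l hp (m F x t) u) Path.Dom Path.rank (coord_m_self hp)
    (dom_of_coord_m_ne_zero hp) (fun _ _ h => h.eq_or_rank_lt) U hU a
    (fun w hw => (sum_coord hp a w).symm.trans (h w hw)) u hu

/-! ### The Murphy basis. -/

theorem linearIndependent_m (hp : ∀ i, p F x (i + 1) ≠ 0) :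
    LinearIndependent F (fun t : Path l => m F x t) := by
  rw [Fintype.linearIndependent_iff]
  intro a ha u
  exact coeff_eq_zero hp (fun _ => False) (fun _ _ _ h => h) a
    (fun w _ => by rw [ha, map_zero, Pi.zero_apply]) u not_false

theorem span_m (hx : x ≠ 0) : Submodule.span F (Set.range fun t : Path l => m F x t) = ⊤ := by
  rw [eq_top_iff]
  rintro c -
  obtain ⟨y, hy⟩ := exists_rep_cell c
  have h := oddProd_mul_mem hx le_rfl (two_mul_fst_le l) y (by rw [lower_eq_top]; trivial)
  obtain ⟨a, ha, b, hb, hab⟩ := Submodule.mem_sup.1 h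
  have key : ∃ d ∈ Submodule.span F (Set.range fun t : Path l => m F x t),
      d.1 = (rightAbove F x l).mkQ a := by
    clear hab
    induction ha using Submodule.span_induction with
    | mem a ha =>
      obtain ⟨s, hs, hsn, rfl⟩ := ha
      refine ⟨m F x (Path.ofWalk hs hsn : Path l), Submodule.subset_span ⟨_, rfl⟩, ?_⟩
      rw [m_val]
      congr 2
      exact walkV_congr fun i hi => by rw [Path.walk_of_le _ hi, Path.ofWalk_idx _ _ hi]
    | zero => exact ⟨0, zero_mem _, by simp⟩
    | add a b _ _ ha hb =>
      obtain ⟨d, hd, h⟩ := ha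
      obtain ⟨d', hd', h'⟩ := hb
      exact ⟨d + d', add_mem hd hd', by rw [Submodule.coe_add, h, h', map_add]⟩
    | smul k a _ ha =>
      obtain ⟨d, hd, h⟩ := ha
      refine ⟨k • d, Submodule.smul_mem _ k hd, ?_⟩
      rw [Submodule.coe_smul_of_tower, h]
      rfl
  obtain ⟨d, hd, h⟩ := key
  have hcd : c = d := by
    apply Subtype.ext
    rw [hy, h, mPart_eq, ← hab, map_add]
    have : (rightAbove F x l).mkQ b = 0 :=
      (Submodule.Quotient.mk_eq_zero _).2 (aboveSpan_le_idealAbove hb)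
    rw [this, add_zero]
  rwa [hcd]

/-- The Murphy basis of the cell module. -/
noncomputable def murphyBasis (hp : ∀ i, p F x (i + 1) ≠ 0) :
    Module.Basis (Path l) F (cell F x l) :=
  Module.Basis.mk (linearIndependent_m hp) (span_m (ne_zero_of_p hp)).ge

theorem murphyBasis_apply (t : Path l) : murphyBasis hp t = m F x t :=
  Module.Basis.mk_apply _ _ t

theorem coord_injective : Function.Injective (coord l hp) := by
  rw [injective_iff_map_eq_zero]
  intro c hc
  rw [← (murphyBasis hp).sum_repr c]
  have h0 : ∀ u, (murphyBasis hp).repr c u = 0 := by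
    intro u
    refine coeff_eq_zero hp (fun _ => False) (fun _ _ _ h => h) _ (fun w _ => ?_) u not_false
    simp only [← murphyBasis_apply hp]
    rw [(murphyBasis hp).sum_repr c, hc, Pi.zero_apply]
  exact Finset.sum_eq_zero fun u _ => by rw [h0 u, zero_smul]

/-! ### The seminormal basis -/

theorem isDiag_list_prod {ι : Type*} (L : List ι) (y : ι → TL F x n) (c : ι → (ℕ → ℕ) → F)
    (h : ∀ i ∈ L, IsDiag hp (y i) (c i)) :
    IsDiag hp (L.map y).prod (fun g => (L.map fun i => c i g).prod) := by
  induction L with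
  | nil => simpa using IsDiag.one hp
  | cons i L ih =>
    simpa using (h i (by simp)).mul hp (ih fun j hj => h j (by simp [hj]))

/-- At the first step where `u` and `t` differ their contents differ, and one linear factor of
`factor t k` vanishes at the content of `u`. -/
theorem coord_f_of_ne {t u : Path l} (h : u ≠ t) : coord l hp (f F x t) u = 0 := by
  classical
  have hd := isDiag_list_prod hp (List.range' 2 (n - 1)) (factor F x t) _ fun k hk =>
    (isDiag_T hp k (by rw [List.mem_range'_1] at hk; omega)).aeval hp _
  rw [f, bigF, coord_isDiag hp hd]
  refine mul_eq_zero_of_left (List.prod_eq_zero ?_) _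
  have hex : ∃ k, u.walk k ≠ t.walk k := by
    by_contra! h'
    exact h (Path.walk_injective (funext h'))
  -- All walks agree at steps `0` and `1`, which is why the product starting at `2` suffices.
  obtain ⟨k, hk⟩ : ∃ k, Nat.find hex = k + 2 := by
    have h1 := Nat.find_spec hex
    have a0 := (u.isWalk_walk 0).1
    have b0 := (t.isWalk_walk 0).1
    have a1 := (u.isWalk_walk 1).1
    have b1 := (t.isWalk_walk 1).1
    rcases hf : Nat.find hex with _ | _ | k
    · rw [hf] at h1; omega
    · rw [hf] at h1; simp only [zero_add] at h1; omega
    · exact ⟨k, rfl⟩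
  have hspec := Nat.find_spec hex
  rw [hk] at hspec
  have hmin : u.walk (k + 1) = t.walk (k + 1) := by
    have := Nat.find_min hex (m := k + 1) (by omega)
    simpa using this
  have hkn : k + 2 ≤ n := by
    by_contra! h'
    exact hspec (by rw [u.walk_of_ge h'.le, t.walk_of_ge h'.le])
  refine List.mem_map.2 ⟨k + 2, by rw [List.mem_range'_1]; omega, ?_⟩
  rw [eval_prod]
  refine Finset.prod_eq_zero (i := walkContent x u.walk (k + 2))
    (Finset.mem_erase.2 ⟨?_, walkContent_mem_contents u.isWalk_walk _⟩) (by simp)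
  rw [r_eq t hkn]
  exact walkContent_ne hp u.isWalk_walk t.isWalk_walk hmin hspec

theorem coord_f_self (t : Path l) : coord l hp (f F x t) t = coord l hp (m F x t) t := by
  classical
  have hd := isDiag_list_prod hp (List.range' 2 (n - 1)) (factor F x t) _ fun k hk =>
    (isDiag_T hp k (by rw [List.mem_range'_1] at hk; omega)).aeval hp _
  rw [f, bigF, coord_isDiag hp hd]
  convert one_mul _
  refine List.prod_eq_one fun a ha => ?_
  obtain ⟨k, hk, rfl⟩ := List.mem_map.1 ha
  rw [List.mem_range'_1] at hk
  rw [eval_prod]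
  refine Finset.prod_eq_one fun b hb => ?_
  rw [← r_eq t (by omega), eval_mul, eval_C, eval_sub, eval_X, eval_C]
  exact inv_mul_cancel₀ (sub_ne_zero.2 (Finset.ne_of_mem_erase hb).symm)

theorem f_triangular (hp : ∀ i, p F x (i + 1) ≠ 0) (t : Path l) : ∃ a : Path l → F,
    f F x t = m F x t + ∑ u with Path.SDom u t, a u • m F x u := by
  classical
  set a := (murphyBasis hp).repr (f F x t) with ha
  have hsum : ∑ u, a u • m F x u = f F x t := by
    simp only [← murphyBasis_apply hp]
    exact (murphyBasis hp).sum_repr _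
  have h0 : ∀ u, ¬ u.Dom t → a u = 0 := by
    refine coeff_eq_zero hp (fun u => u.Dom t) (fun _ _ h h' => h.trans h') a fun w hw => ?_
    rw [hsum]
    refine coord_f_of_ne hp ?_
    rintro rfl
    exact hw fun k => le_rfl
  -- In the coordinate at `t` no other term survives: a path strictly dominating `t` has a Murphy
  -- element with zero `t`-coordinate, and `f t` and `m t` share theirs.
  have h1 : a t = 1 := by
    have h := congrArg (fun c => coord l hp c t) hsum
    simp only [sum_coord, coord_f_self] at h
    rw [Finset.sum_eq_single t] at h
    · exact mul_right_cancel₀ (coord_m_self hp t) (h.trans (one_mul _).symm)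
    · intro u _ hut
      by_cases hu : u.Dom t
      · by_cases hM : coord l hp (m F x u) t = 0
        · rw [hM, mul_zero]
        · have h2 := hu.eq_or_rank_lt.resolve_left hut
          have h3 := (dom_of_coord_m_ne_zero hp u t hM).eq_or_rank_lt.resolve_left hut.symm
          omega
      · rw [h0 u hu, zero_mul]
    · exact fun h' => absurd (Finset.mem_univ t) h'
  refine ⟨a, ?_⟩
  rw [← hsum, ← Finset.add_sum_erase _ _ (Finset.mem_univ t), h1, one_smul]
  congr 1
  symm
  refine Finset.sum_subset (fun u hu => ?_) fun u hu hu' => ?_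
  · rw [Finset.mem_filter] at hu
    exact Finset.mem_erase.2 ⟨hu.2.2, Finset.mem_univ u⟩
  · have : ¬ u.Dom t := fun h =>
      hu' (Finset.mem_filter.2 ⟨Finset.mem_univ u, h, Finset.ne_of_mem_erase hu⟩)
    rw [h0 u this, zero_smul]

theorem linearIndependent_f (hp : ∀ i, p F x (i + 1) ≠ 0) :
    LinearIndependent F (fun t : Path l => f F x t) := by
  rw [Fintype.linearIndependent_iff]
  intro a ha u
  have h := congrArg (fun c => coord l hp c u) ha
  simp only [map_sum, Finset.sum_apply, map_smul, Pi.smul_apply, smul_eq_mul, map_zero,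
    Pi.zero_apply] at h
  rw [Finset.sum_eq_single u] at h
  · rw [coord_f_self] at h
    exact (mul_eq_zero.1 h).resolve_right (coord_m_self hp u)
  · intro t _ htu
    rw [coord_f_of_ne hp htu.symm, mul_zero]
  · exact fun h' => absurd (Finset.mem_univ u) h'

theorem span_f (hp : ∀ i, p F x (i + 1) ≠ 0) :
    Submodule.span F (Set.range fun t : Path l => f F x t) = ⊤ :=
  have := (murphyBasis (l := l) hp).finiteDimensional_of_finite
  (linearIndependent_f hp).span_eq_top_of_card_eq_finrank'
    (Module.finrank_eq_card_basis (murphyBasis hp)).symm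

theorem op_smul_f {y : TL F x n} {c : (ℕ → ℕ) → F} (h : IsDiag hp y c) (t : Path l) :
    MulOpposite.op y • f F x t = c t.walk • f F x t := by
  apply coord_injective hp
  funext u
  rw [coord_isDiag hp h, map_smul, Pi.smul_apply, smul_eq_mul]
  by_cases hu : u = t
  · rw [hu]
  · rw [coord_f_of_ne hp hu, mul_zero, mul_zero]

/-! ### The cellular form -/

theorem exists_isCellForm (hp : ∀ i, p F x (i + 1) ≠ 0) : ∃ B, IsCellForm F x l B := by
  have h : ∀ s t : Path l, ∃ c : F,
      mPart F x l * (v F x s * vStar F x t) * mPart F x l - c • mPart F x l ∈ idealAbove F x l := by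
    intro s t
    obtain ⟨c, hc⟩ := oddProd_sandwich_mem (F := F) (x := x) (two_mul_fst_le l) le_rfl
      (y := v F x s * vStar F x t) (by rw [lower_eq_top]; trivial)
    exact ⟨c, aboveSpan_le_idealAbove hc⟩
  choose β hβ using h
  refine ⟨(murphyBasis hp).constr F fun s => (murphyBasis hp).constr F (β s), ?_⟩
  intro u s t w
  have hB : (murphyBasis hp).constr F (fun s => (murphyBasis hp).constr F (β s))
      (m F x s) (m F x t) = β s t := by
    rw [← murphyBasis_apply hp, ← murphyBasis_apply hp, Module.Basis.constr_basis,
      Module.Basis.constr_basis]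
  rw [hB]
  have := mul_mem_idealAbove (a := vStar F x u) (b := v F x w) (hβ s t)
  convert this using 1
  simp only [mPair, mul_sub, sub_mul, mul_smul_comm, smul_mul_assoc, mul_assoc]

open Classical in
variable (l) in
/-- The set of infinite walks that continue the paths of shape `l`. -/
noncomputable def walks : Finset (ℕ → ℕ) := Finset.univ.image (Path.walk : Path l → ℕ → ℕ)

theorem mem_walks (g : ℕ → ℕ) : g ∈ walks l ↔ IsWalk g ∧ ∀ i, n ≤ i → g i = l.fst := by
  classical
  rw [walks, Finset.mem_image]
  constructor
  · rintro ⟨t, -, rfl⟩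
    exact ⟨t.isWalk_walk, fun i => t.walk_of_ge⟩
  · rintro ⟨hg, h⟩
    exact ⟨_, Finset.mem_univ _, Path.ofWalk_walk hg h⟩

theorem walk_mem_walks (t : Path l) : t.walk ∈ walks l :=
  (mem_walks _).2 ⟨t.isWalk_walk, fun _ => t.walk_of_ge⟩

theorem walkForm_indic {W : Finset (ℕ → ℕ)} {g : ℕ → ℕ} (hg : g ∈ W) (ψ : (ℕ → ℕ) → F) :
    walkForm x n W (indic g) ψ = weight x n g * ψ g := by
  rw [walkForm, Finset.sum_eq_single g]
  · rw [indic_self, mul_one]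
  · intro g' _ h
    rw [indic_of_ne h, mul_zero, zero_mul]
  · exact fun h => absurd hg h

theorem isAdj_oddProd_mul_walkV (t : Path l) : IsAdj hp n (walks l)
    (oddProd F x n l.fst * walkV F x n t.walk n)
    (walkVStar F x n t.walk n * oddProd F x n l.fst) :=
  (isAdj_oddProd hp mem_walks l.fst).mul hp (isAdj_walkV hp mem_walks t.isWalk_walk n)

/-- The adjoint of `m_λ v_t`, applied to the most dominant path, in coordinates. -/
theorem weight_mul_rep_adjoint (t u : Path l) :
    weight x n u.walk * rep hp n (walkVStar F x n t.walk n * oddProd F x n l.fst)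
      (indic (topWalk l.fst)) u.walk =
    weight x n (topWalk l.fst) * coord l hp (m F x t) u := by
  have hadj := isAdj_oddProd_mul_walkV hp t
  rw [← walkForm_indic (walk_mem_walks u), ← hadj, walkForm_comm,
    walkForm_indic (topPath_walk (l := l) ▸ walk_mem_walks (topPath l)),
    coord_apply hp (m_val t)]

/-- The adjoint of `m_λ v_s` is `v_s^* m_λ`, so the value at the most dominant path becomes a sum
over all paths of the coordinates of both arguments. -/
theorem isCellForm_apply {B : LinearMap.BilinForm F (cell F x l)} (hB : IsCellForm F x l B)
    (s t : Path l) : B (m F x s) (m F x t) = ∑ u : Path l,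
      weight x n (topWalk l.fst) / (x ^ l.fst * weight x n u.walk) *
        coord l hp (m F x s) u * coord l hp (m F x t) u := by
  classical
  have htop : topWalk l.fst ∈ walks l := topPath_walk (l := l) ▸ walk_mem_walks (topPath l)
  have hx : x ^ l.fst ≠ 0 := pow_ne_zero _ (ne_zero_of_p hp)
  have hw := fun g => weight_ne_zero (x := x) n g hp
  -- With the most dominant path at both ends the outer `v` and `v^*` are `1`, and `m_λ` acts at
  -- that path by `x ^ l.fst`, so the form can be isolated.
  have h1 := hB (topPath l) s t (topPath l)
  simp only [mPair, v_topPath, vStar_topPath, one_mul, mul_one] at h1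
  have h2 := rep_idealAbove hp h1 (isWalk_topWalk l.fst) (topWalk_of_ge l le_rfl)
    (indic (topWalk l.fst))
  rw [map_sub, map_smul, LinearMap.sub_apply, LinearMap.smul_apply, Pi.sub_apply, Pi.smul_apply,
    smul_eq_mul, sub_eq_zero, mPart_eq, rep_oddProd_top hp (two_mul_fst_le l) (isWalk_topWalk _)
      (fun i hi => by simp only [topWalk]; omega), indic_self, mul_one, v_eq, vStar_eq,
    rep_mul_apply] at h2
  have hadj := isAdj_oddProd_mul_walkV hp s
  have h3 := walkForm_indic (x := x) (n := n) htop
    (rep hp n (oddProd F x n l.fst * walkV F x n s.walk n)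
      (rep hp n (walkVStar F x n t.walk n * oddProd F x n l.fst) (indic (topWalk l.fst))))
  rw [h2, walkForm_comm, hadj, walkForm, walks,
    Finset.sum_image fun a _ b _ h => Path.walk_injective h] at h3
  have h4 : ∀ t u : Path l, rep hp n (walkVStar F x n t.walk n * oddProd F x n l.fst)
      (indic (topWalk l.fst)) u.walk =
      weight x n (topWalk l.fst) * coord l hp (m F x t) u / weight x n u.walk := by
    intro t u
    rw [eq_div_iff (hw _), mul_comm, weight_mul_rep_adjoint]
  simp only [h4] at h3
  refine mul_right_cancel₀ hx (mul_left_cancel₀ (hw (topWalk l.fst)) (h3.symm.trans ?_))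
  rw [Finset.sum_mul, Finset.mul_sum]
  refine Finset.sum_congr rfl fun u _ => ?_
  have := hw u.walk
  field_simp

theorem isCellForm_eq_sum {B : LinearMap.BilinForm F (cell F x l)} (hB : IsCellForm F x l B)
    (c d : cell F x l) : B c d = ∑ u : Path l,
      weight x n (topWalk l.fst) / (x ^ l.fst * weight x n u.walk) *
        coord l hp c u * coord l hp d u := by
  let G : LinearMap.BilinForm F (cell F x l) := ∑ u : Path l,
    (weight x n (topWalk l.fst) / (x ^ l.fst * weight x n u.walk)) •
      (LinearMap.mul F F).compl₁₂ (LinearMap.proj u ∘ₗ coord l hp) (LinearMap.proj u ∘ₗ coord l hp)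
  have hG : ∀ c d, G c d = ∑ u : Path l,
      weight x n (topWalk l.fst) / (x ^ l.fst * weight x n u.walk) *
        coord l hp c u * coord l hp d u := by
    intro c d
    simp [G, LinearMap.sum_apply, mul_assoc]
  have : B = G := by
    refine (murphyBasis hp).ext fun s => (murphyBasis hp).ext fun t => ?_
    rw [murphyBasis_apply, murphyBasis_apply, hG, isCellForm_apply hp hB]
  rw [this, hG]

end Cell

end TemperleyLieb

/-! ### The main theorem. -/

theorem mainTheorem6 (F : Type*) [Field F] [Algebra (Polynomial ℤ) F]
    [IsFractionRing (Polynomial ℤ) F] (x : F)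
    (hx : x = algebraMap (Polynomial ℤ) F Polynomial.X)
    (n : ℕ) (l : TemperleyLieb.Part n) :
    (∀ t : TemperleyLieb.Path l, ∃ a : TemperleyLieb.Path l → F,
      TemperleyLieb.f F x t = TemperleyLieb.m F x t +
        ∑ u with TemperleyLieb.Path.SDom u t, a u • TemperleyLieb.m F x u) ∧
    (LinearIndependent F (fun t : TemperleyLieb.Path l => TemperleyLieb.f F x t) ∧
      Submodule.span F (Set.range fun t : TemperleyLieb.Path l => TemperleyLieb.f F x t) = ⊤) ∧
    ((∃! B, TemperleyLieb.IsCellForm F x l B) ∧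
      ∀ B, TemperleyLieb.IsCellForm F x l B →
        (∀ s t : TemperleyLieb.Path l, s ≠ t →
          B (TemperleyLieb.f F x s) (TemperleyLieb.f F x t) = 0) ∧
        ∀ t : TemperleyLieb.Path l,
          B (TemperleyLieb.f F x t) (TemperleyLieb.f F x t) ≠ 0) ∧
    (∀ (t : TemperleyLieb.Path l) (k : ℕ), k ≤ n →
      MulOpposite.op (TemperleyLieb.T F x n k) • TemperleyLieb.f F x t =
          TemperleyLieb.r F x t k • TemperleyLieb.f F x t ∧
        MulOpposite.op (TemperleyLieb.z F x n k) • TemperleyLieb.f F x t =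
          TemperleyLieb.zContent F x t k • TemperleyLieb.f F x t) := by
  have hp : ∀ i, TemperleyLieb.p F x (i + 1) ≠ 0 := fun i => hx ▸ TemperleyLieb.p_ne_zero i
  refine ⟨TemperleyLieb.f_triangular hp, ⟨TemperleyLieb.linearIndependent_f hp,
    TemperleyLieb.span_f hp⟩, ⟨?_, fun B hB => ⟨fun s t hst => ?_, fun t => ?_⟩⟩, fun t k hk => ?_⟩
  · obtain ⟨B, hB⟩ := TemperleyLieb.exists_isCellForm (l := l) hp
    refine ⟨B, hB, fun B' hB' => ?_⟩
    refine LinearMap.ext₂ fun c d => ?_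
    -- The diagonal formula does not mention the form, so two cellular forms agree.
    rw [TemperleyLieb.isCellForm_eq_sum hp hB, TemperleyLieb.isCellForm_eq_sum hp hB']
  · rw [TemperleyLieb.isCellForm_eq_sum hp hB]
    refine Finset.sum_eq_zero fun u _ => ?_
    by_cases hu : u = s
    · rw [TemperleyLieb.coord_f_of_ne hp (t := t) (by rw [hu]; exact hst), mul_zero]
    · rw [TemperleyLieb.coord_f_of_ne hp hu, mul_zero, zero_mul]
  · rw [TemperleyLieb.isCellForm_eq_sum hp hB, Finset.sum_eq_single t]
    · rw [TemperleyLieb.coord_f_self]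
      have h0 := TemperleyLieb.coord_m_self hp t
      exact mul_ne_zero (mul_ne_zero (div_ne_zero (TemperleyLieb.weight_ne_zero n _ hp)
        (mul_ne_zero (pow_ne_zero _ (TemperleyLieb.ne_zero_of_p hp))
          (TemperleyLieb.weight_ne_zero n _ hp))) h0) h0
    · intro u _ hu
      rw [TemperleyLieb.coord_f_of_ne hp hu, mul_zero]
    · exact fun h => absurd (Finset.mem_univ t) h
  · rw [TemperleyLieb.r_eq t hk, TemperleyLieb.zContent_eq t hk]
    exact ⟨TemperleyLieb.op_smul_f hp (TemperleyLieb.isDiag_T hp k hk) t,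
      TemperleyLieb.op_smul_f hp (TemperleyLieb.isDiag_z hp k hk) t⟩
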